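/- Let $I\subset\mathbb{R}$ be a bounded interval, let $\mu$ be a finite positive Borel measure on $I$ (possibly with singular part and atoms), and let $\nu$ be a Borel measure on $\mathbb{R}$. For $u\in L^2_\mu$ let $\Gamma(u)$ be the set of all $v\in L^2_\mu$ for which there is a sequence of smooth functions $\varphi_n:\mathbb{R}\to\mathbb{R}$ with $\varphi_n\to u$ and $\varphi_n'\to v$ in $L^2_\mu$. Let $H^1_\mu=\{u\in L^2_\mu:\Gamma(u)\neq\emptyset\}$ and, for $u\in H^1_\mu$, let $\nabla_\mu u$ be the unique element of $\Gamma(u)$ of minimal $L^2_\mu$-norm. Assume that there is at least one $T\in H^1_\mu$ with $T_\#\mu=\nu$. Then the problem $$\inf\left\{\int_I\left(|T(x)-x|^2+|\nabla_\mu T(x)|^2\right)d\mu(x)\;:\;T\in H^1_\mu,\ T_\#\mu=\nu\right\}$$ admits at least one solution: the infimum is attained by some $T\in H^1_\mu$ with $T_\#\mu=\nu$. -/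

import Mathlib

open MeasureTheory Filter Topology
open scoped ENNReal ContDiff

/-- The graph of the classical derivative in `L²_μ × L²_μ`: the pairs `(φ, φ')` of (classes of)
square-integrable functions, where `φ` is smooth. When `μ` is concentrated on a bounded interval
`I`, the classes of such `φ` are exactly those of the elements of `C^∞` of the closure of `I`
(restrictions to the closure of smooth functions on the line), and the integrability of `φ` and
`φ'` is automatic. -/
def smoothGraph (μ : Measure ℝ) : Set (Lp ℝ 2 μ × Lp ℝ 2 μ) :=
  {p | ∃ φ : ℝ → ℝ, ContDiff ℝ ∞ φ ∧ p.1 =ᵐ[μ] φ ∧ p.2 =ᵐ[μ] deriv φ}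

/-- `Γ(u)`, the set of gradients of `u`: the `L²_μ`-limits `v` of `φ_n'`, for sequences of smooth
functions `φ_n` converging to `u` in `L²_μ`. -/
def gradients (μ : Measure ℝ) (u : Lp ℝ 2 μ) : Set (Lp ℝ 2 μ) :=
  {v | ∃ a b : ℕ → Lp ℝ 2 μ, (∀ n, (a n, b n) ∈ smoothGraph μ) ∧
    Tendsto a atTop (𝓝 u) ∧ Tendsto b atTop (𝓝 v)}

/-- The Sobolev space `H¹_μ`: the elements of `L²_μ` that have at least one gradient. -/
def sobolevSpace (μ : Measure ℝ) : Set (Lp ℝ 2 μ) :=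
  {u | (gradients μ u).Nonempty}

theorem mem_gradients_iff_closure {μ : Measure ℝ} {u v : Lp ℝ 2 μ} :
    v ∈ gradients μ u ↔ (u, v) ∈ closure (smoothGraph μ) := by
  rw [mem_closure_iff_seq_limit]
  constructor
  · rintro ⟨a, b, hab, ha, hb⟩
    exact ⟨fun n => (a n, b n), hab, ha.prodMk_nhds hb⟩
  · rintro ⟨p, hp, hlim⟩
    exact ⟨fun n => (p n).1, fun n => (p n).2, hp,
      (continuous_fst.tendsto _).comp hlim, (continuous_snd.tendsto _).comp hlim⟩

theorem convex_smoothGraph (μ : Measure ℝ) : Convex ℝ (smoothGraph μ) := by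
  rintro ⟨p₁, p₂⟩ ⟨φ, hφ, hp₁, hp₂⟩ ⟨q₁, q₂⟩ ⟨ψ, hψ, hq₁, hq₂⟩ s t _ _ _
  have hφd := hφ.differentiable (by simp)
  have hψd := hψ.differentiable (by simp)
  refine ⟨s • φ + t • ψ, (hφ.const_smul s).add (hψ.const_smul t), ?_, ?_⟩
  · have h1 := Lp.coeFn_add (s • p₁) (t • q₁)
    have h2 := Lp.coeFn_smul s p₁
    have h3 := Lp.coeFn_smul t q₁
    filter_upwards [h1, h2, h3, hp₁, hq₁] with x h1 h2 h3 h4 h5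
    change (s • p₁ + t • q₁ : Lp ℝ 2 μ) x = s • φ x + t • ψ x
    rw [h1, Pi.add_apply, h2, h3, Pi.smul_apply, Pi.smul_apply, show p₁ x = φ x from h4,
      show q₁ x = ψ x from h5]
  · have h1 := Lp.coeFn_add (s • p₂) (t • q₂)
    have h2 := Lp.coeFn_smul s p₂
    have h3 := Lp.coeFn_smul t q₂
    filter_upwards [h1, h2, h3, hp₂, hq₂] with x h1 h2 h3 h4 h5
    have hd : HasDerivAt (s • φ + t • ψ) (s • deriv φ x + t • deriv ψ x) x :=
      ((hφd x).hasDerivAt.const_smul s).add ((hψd x).hasDerivAt.const_smul t)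
    change (s • p₂ + t • q₂ : Lp ℝ 2 μ) x = deriv (s • φ + t • ψ) x
    rw [hd.deriv, h1, Pi.add_apply, h2, h3, Pi.smul_apply, Pi.smul_apply,
      show p₂ x = deriv φ x from h4, show q₂ x = deriv ψ x from h5]

theorem convex_gradients (μ : Measure ℝ) (u : Lp ℝ 2 μ) : Convex ℝ (gradients μ u) := by
  intro v hv w hw s t hs ht hst
  rw [mem_gradients_iff_closure] at *
  have h := (convex_smoothGraph μ).closure hv hw hs ht hst
  rwa [Prod.smul_mk, Prod.smul_mk, Prod.mk_add_mk, ← add_smul, hst, one_smul] at h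

theorem isClosed_gradients (μ : Measure ℝ) (u : Lp ℝ 2 μ) : IsClosed (gradients μ u) := by
  have h : gradients μ u = (fun v => (u, v)) ⁻¹' closure (smoothGraph μ) := by
    ext v
    exact mem_gradients_iff_closure
  rw [h]
  exact isClosed_closure.preimage (by fun_prop)

/-- Every `u` in `H¹_μ` has exactly one gradient of minimal `L²_μ`-norm. -/
theorem existsUnique_minimal_gradient {μ : Measure ℝ} {u : Lp ℝ 2 μ} (hu : u ∈ sobolevSpace μ) :
    ∃! v, v ∈ gradients μ u ∧ ∀ w ∈ gradients μ u, ‖v‖ ≤ ‖w‖ := by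
  have hc := convex_gradients μ u
  obtain ⟨v, hv, hmin⟩ := exists_norm_eq_iInf_of_complete_convex hu
    (isClosed_gradients μ u).isComplete hc 0
  have hle : ∀ w ∈ gradients μ u, ‖v‖ ≤ ‖w‖ := by
    intro w hw
    have h1 : (⨅ w : gradients μ u, ‖(0 : Lp ℝ 2 μ) - w‖) ≤ ‖(0 : Lp ℝ 2 μ) - w‖ :=
      ciInf_le ⟨0, by rintro _ ⟨y, rfl⟩; exact norm_nonneg _⟩ (⟨w, hw⟩ : gradients μ u)
    rw [← hmin] at h1
    simpa using h1
  refine ⟨v, ⟨hv, hle⟩, ?_⟩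
  rintro w ⟨hw, hwle⟩
  have heq : ‖v‖ = ‖w‖ := le_antisymm (hle w hw) (hwle v hv)
  have hm := hle _ (hc hv hw (a := 1 / 2) (b := 1 / 2) (by norm_num) (by norm_num) (by norm_num))
  rw [← smul_add, norm_smul] at hm
  have hp := parallelogram_law_with_norm ℝ v w
  have h0 : ‖v - w‖ = 0 := by
    norm_num at hm
    nlinarith [norm_nonneg v, norm_nonneg (v - w), norm_nonneg (v + w)]
  exact (sub_eq_zero.mp (norm_eq_zero.mp h0)).symm

open Classical in
/-- The tangential gradient `∇_μ u`: the element of `Γ(u)` of minimal `L²_μ`-norm, that is the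
projection of `0` onto `Γ(u)` (and `0`, by convention, when `u` is not in `H¹_μ`). -/
noncomputable def tangentialGradient (μ : Measure ℝ) (u : Lp ℝ 2 μ) : Lp ℝ 2 μ :=
  if hu : u ∈ sobolevSpace μ then (existsUnique_minimal_gradient hu).choose else 0

theorem tangentialGradient_spec {μ : Measure ℝ} {u : Lp ℝ 2 μ} (hu : u ∈ sobolevSpace μ) :
    tangentialGradient μ u ∈ gradients μ u ∧
      ∀ w ∈ gradients μ u, ‖tangentialGradient μ u‖ ≤ ‖w‖ := by
  rw [tangentialGradient, dif_pos hu]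
  exact (existsUnique_minimal_gradient hu).choose_spec.1

/-- The functional `∫ (|T(x) - x|² + |∇_μ T(x)|²) dμ(x)`, with values in `[0, ∞]`. -/
noncomputable def transportEnergy (μ : Measure ℝ) (T : Lp ℝ 2 μ) : ℝ≥0∞ :=
  ∫⁻ x, ENNReal.ofReal (|T x - x| ^ 2 + |tangentialGradient μ T x| ^ 2) ∂μ

/-- The Sobolev transport maps from `μ` to `ν`: the `T ∈ H¹_μ` with `T_# μ = ν`. -/
def sobolevTransportMaps (μ ν : Measure ℝ) : Set (Lp ℝ 2 μ) :=
  {T | T ∈ sobolevSpace μ ∧ Measure.map T μ = ν}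

/-- A bounded sequence in a separable Hilbert space has a weakly convergent subsequence. -/
theorem exists_subseq_tendsto_inner {H : Type*} [NormedAddCommGroup H] [InnerProductSpace ℝ H]
    [CompleteSpace H] [TopologicalSpace.SeparableSpace H] {x : ℕ → H} {r : ℝ}
    (hx : ∀ n, ‖x n‖ ≤ r) :
    ∃ (a : H) (σ : ℕ → ℕ), StrictMono σ ∧
      ∀ w, Tendsto (fun n => inner ℝ (x (σ n)) w) atTop (𝓝 (inner ℝ a w)) := by
  let J : H → WeakDual ℝ H := fun a => StrongDual.toWeakDual (InnerProductSpace.toDual ℝ H a)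
  have hmem : ∀ n, J (x n) ∈ WeakDual.toStrongDual ⁻¹' Metric.closedBall 0 r := by
    intro n
    simpa [J] using hx n
  obtain ⟨f, -, σ, hσ, hf⟩ := WeakDual.isSeqCompact_closedBall ℝ H 0 r hmem
  refine ⟨(InnerProductSpace.toDual ℝ H).symm (WeakDual.toStrongDual f), σ, hσ, fun w => ?_⟩
  have h := ((WeakDual.eval_continuous (𝕜 := ℝ) (E := H) w).tendsto f).comp hf
  simpa [J, Function.comp_def] using h

theorem tendsto_dual_of_tendsto_inner {H : Type*} [NormedAddCommGroup H] [InnerProductSpace ℝ H]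
    [CompleteSpace H] {x : ℕ → H} {a : H}
    (h : ∀ w, Tendsto (fun n => inner ℝ (x n) w) atTop (𝓝 (inner ℝ a w))) (F : StrongDual ℝ H) :
    Tendsto (fun n => F (x n)) atTop (𝓝 (F a)) := by
  have h1 := h ((InnerProductSpace.toDual ℝ H).symm F)
  simpa only [fun y => real_inner_comm ((InnerProductSpace.toDual ℝ H).symm F) y,
    InnerProductSpace.toDual_symm_apply] using h1

theorem norm_le_of_tendsto_inner {H : Type*} [NormedAddCommGroup H] [InnerProductSpace ℝ H]
    {x : ℕ → H} {a : H} {l : ℝ}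
    (h : ∀ w, Tendsto (fun n => inner ℝ (x n) w) atTop (𝓝 (inner ℝ a w)))
    (hl : Tendsto (fun n => ‖x n‖) atTop (𝓝 l)) : ‖a‖ ≤ l := by
  have h1 : inner ℝ a a ≤ l * ‖a‖ :=
    le_of_tendsto_of_tendsto' (h a) (hl.mul_const _) fun n => real_inner_le_norm _ _
  rw [real_inner_self_eq_norm_mul_norm] at h1
  have hl0 : 0 ≤ l := ge_of_tendsto' hl fun n => norm_nonneg _
  rcases (norm_nonneg a).eq_or_lt with h0 | h0
  · rwa [← h0]
  · exact le_of_mul_le_mul_right h1 h0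

/-- A closed subspace is weakly sequentially closed. -/
theorem Submodule.mem_of_tendsto_dual {E : Type*} [NormedAddCommGroup E] [NormedSpace ℝ E]
    {K : Submodule ℝ E} (hK : IsClosed (K : Set E)) {x : ℕ → E} {a : E} (hx : ∀ n, x n ∈ K)
    (h : ∀ F : StrongDual ℝ E, Tendsto (fun n => F (x n)) atTop (𝓝 (F a))) : a ∈ K := by
  by_contra ha
  obtain ⟨F, u, hFa, hFb⟩ := geometric_hahn_banach_point_closed K.convex hK ha
  have h0 : ∀ b ∈ K, F b = 0 := by
    intro b hb
    by_contra hne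
    have h1 := hFb (((u - 1) / F b) • b) (K.smul_mem _ hb)
    rw [map_smul, smul_eq_mul, div_mul_cancel₀ _ hne] at h1
    linarith
  have h1 : F a = 0 := tendsto_nhds_unique (h F) (by simp [h0 _ (hx _)])
  have h2 := hFb 0 K.zero_mem
  simp only [map_zero] at h2
  linarith

theorem exists_smooth_step : ∃ (s : ℝ → ℝ) (K : ℝ), 0 < K ∧ ContDiff ℝ ∞ s ∧
    (∀ t, s t ∈ Set.Icc (0 : ℝ) 1) ∧ (∀ t ≤ 1 / 3, s t = 0) ∧ (∀ t, 2 / 3 ≤ t → s t = 1) ∧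
    ∀ t, |deriv s t| ≤ K := by
  let s : ℝ → ℝ := fun t => Real.smoothTransition (3 * t - 1)
  have hs : ContDiff ℝ ∞ s := Real.smoothTransition.contDiff.comp (by fun_prop)
  have h0 : ∀ t ≤ 1 / 3, s t = 0 := fun t ht =>
    Real.smoothTransition.zero_of_nonpos (by linarith)
  have h1 : ∀ t, 2 / 3 ≤ t → s t = 1 := fun t ht =>
    Real.smoothTransition.one_of_one_le (by linarith)
  have hc : Continuous (deriv s) := hs.continuous_deriv (by simp)
  obtain ⟨K, hK⟩ := (isCompact_Icc (a := (0 : ℝ)) (b := 1)).exists_bound_of_continuousOn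
    hc.continuousOn
  refine ⟨s, max K 1, by positivity, hs,
    fun t => ⟨Real.smoothTransition.nonneg _, Real.smoothTransition.le_one _⟩, h0, h1, ?_⟩
  intro t
  by_cases ht : t ∈ Set.Icc (0 : ℝ) 1
  · exact (hK t ht).trans (le_max_left _ _)
  · have hd : deriv s t = 0 := by
      rw [Set.mem_Icc, not_and_or, not_le, not_le] at ht
      rcases ht with ht | ht
      · have : s =ᶠ[𝓝 t] fun _ => 0 := by
          filter_upwards [Iio_mem_nhds ht] with r hr
          exact h0 r (by linarith [Set.mem_Iio.1 hr])
        rw [this.deriv_eq, deriv_const]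
      · have : s =ᶠ[𝓝 t] fun _ => 1 := by
          filter_upwards [Ioi_mem_nhds ht] with r hr
          exact h1 r (by linarith [Set.mem_Ioi.1 hr])
        rw [this.deriv_eq, deriv_const]
    rw [hd, abs_zero]
    positivity

/-- A smooth function that takes distinct values at `x < y` can be truncated to a smooth function
from `0` on the left of `x` to `1` on the right of `y`, with control of the derivative. -/
theorem exists_truncation : ∃ K : ℝ, 0 < K ∧ ∀ (φ : ℝ → ℝ) (x y : ℝ), ContDiff ℝ ∞ φ → x < y →
    φ x ≠ φ y → ∃ f : ℝ → ℝ, ContDiff ℝ ∞ f ∧ (∀ t ≤ x, f t = 0) ∧ (∀ t, y ≤ t → f t = 1) ∧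
      (∀ t, f t ∈ Set.Icc (0 : ℝ) 1) ∧ ∀ t, |deriv f t| ≤ K / |φ x - φ y| * |deriv φ t| := by
  obtain ⟨s, K, hK, hs, hs01, hs0, hs1, hsd⟩ := exists_smooth_step
  refine ⟨K, hK, fun φ x y hφ hxy hne => ?_⟩
  have hd0 : φ y - φ x ≠ 0 := sub_ne_zero.2 hne.symm
  let ψ : ℝ → ℝ := fun t => (φ t - φ x) / (φ y - φ x)
  have hψ : ContDiff ℝ ∞ ψ := (hφ.sub contDiff_const).div_const _
  have hψx : ψ x = 0 := by simp [ψ]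
  have hψy : ψ y = 1 := by simp [ψ, hd0]
  let f : ℝ → ℝ := fun t => if t ≤ x then 0 else if y ≤ t then 1 else s (ψ t)
  have hf0 : ∀ t ≤ x, f t = 0 := fun t ht => if_pos ht
  have hf1 : ∀ t, y ≤ t → f t = 1 := fun t ht => by
    simp only [f]
    rw [if_neg (by linarith), if_pos ht]
  have hloc : ∀ t, (∃ c : ℝ, f =ᶠ[𝓝 t] fun _ => c) ∨ f =ᶠ[𝓝 t] s ∘ ψ := by
    intro t
    rcases lt_trichotomy t x with ht | rfl | ht
    · left
      refine ⟨0, ?_⟩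
      filter_upwards [Iio_mem_nhds ht] with r hr
      exact hf0 r (le_of_lt hr)
    · left
      refine ⟨0, ?_⟩
      have h1 : ∀ᶠ r in 𝓝 t, ψ r < 1 / 3 :=
        hψ.continuous.continuousAt.eventually_lt continuousAt_const (by rw [hψx]; norm_num)
      filter_upwards [h1, Iio_mem_nhds hxy] with r hr hr'
      simp only [f]
      rw [hs0 _ hr.le, if_neg (not_le.2 (Set.mem_Iio.1 hr') : ¬ y ≤ r), ite_self]
    rcases lt_trichotomy t y with ht' | rfl | ht'
    · right
      filter_upwards [Ioo_mem_nhds ht ht'] with r hr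
      simp only [f, Function.comp]
      rw [if_neg (not_le.2 hr.1), if_neg (not_le.2 hr.2)]
    · left
      refine ⟨1, ?_⟩
      have h1 : ∀ᶠ r in 𝓝 t, 2 / 3 < ψ r :=
        continuousAt_const.eventually_lt hψ.continuous.continuousAt (by rw [hψy]; norm_num)
      filter_upwards [h1, Ioi_mem_nhds hxy] with r hr hr'
      simp only [f]
      rw [hs1 _ hr.le, if_neg (not_le.2 (Set.mem_Ioi.1 hr') : ¬ r ≤ x), ite_self]
    · left
      refine ⟨1, ?_⟩
      filter_upwards [Ioi_mem_nhds ht'] with r hr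
      exact hf1 r (le_of_lt hr)
  refine ⟨f, ?_, hf0, hf1, ?_, ?_⟩
  · rw [contDiff_iff_contDiffAt]
    intro t
    rcases hloc t with ⟨c, h⟩ | h
    · exact contDiffAt_const.congr_of_eventuallyEq h
    · exact (hs.comp hψ).contDiffAt.congr_of_eventuallyEq h
  · intro t
    simp only [f]
    split_ifs
    · simp
    · simp
    · exact hs01 _
  · intro t
    rcases hloc t with ⟨c, h⟩ | h
    · rw [h.deriv_eq, deriv_const, abs_zero]
      positivity
    · have hφd : HasDerivAt ψ (deriv φ t / (φ y - φ x)) t :=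
        (((hφ.differentiable (by simp)) t).hasDerivAt.sub_const _).div_const _
      have hsd' := ((hs.differentiable (by simp)) (ψ t)).hasDerivAt
      rw [h.deriv_eq, (hsd'.comp t hφd).deriv, abs_mul, abs_div, abs_sub_comm (φ y)]
      calc |deriv s (ψ t)| * (|deriv φ t| / |φ x - φ y|)
          ≤ K * (|deriv φ t| / |φ x - φ y|) := by gcongr; exact hsd _
        _ = _ := by ring

theorem memLp_two_of_continuous {μ : Measure ℝ} [IsFiniteMeasure μ] {R : ℝ}
    (hb : ∀ᵐ x ∂μ, |x| ≤ R) {f : ℝ → ℝ} (hf : Continuous f) : MemLp f 2 μ := by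
  obtain ⟨C, hC⟩ := (isCompact_Icc (a := -R) (b := R)).exists_bound_of_continuousOn
    hf.continuousOn
  refine MemLp.of_bound hf.aestronglyMeasurable C ?_
  filter_upwards [hb] with x hx
  exact hC x (abs_le.1 hx)

/-- The space of smooth functions on the line. -/
def smoothFunctions : Submodule ℝ (ℝ → ℝ) where
  carrier := {φ | ContDiff ℝ ∞ φ}
  zero_mem' := (contDiff_const : ContDiff ℝ ∞ fun _ : ℝ => (0 : ℝ))
  add_mem' := by
    intro f g (hf : ContDiff ℝ ∞ f) (hg : ContDiff ℝ ∞ g)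
    exact hf.add hg
  smul_mem' := by
    intro c f (hf : ContDiff ℝ ∞ f)
    exact hf.const_smul c

theorem contDiff_smoothFunctions (φ : smoothFunctions) : ContDiff ℝ ∞ (φ : ℝ → ℝ) := φ.2

theorem differentiable_smoothFunctions (φ : smoothFunctions) : Differentiable ℝ (φ : ℝ → ℝ) :=
  (contDiff_smoothFunctions φ).differentiable (by simp)

theorem continuous_deriv_smoothFunctions (φ : smoothFunctions) :
    Continuous (deriv (φ : ℝ → ℝ)) :=
  (contDiff_smoothFunctions φ).continuous_deriv (by simp)

theorem memLp_smoothFunctions {μ : Measure ℝ} [IsFiniteMeasure μ] {R : ℝ}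
    (hb : ∀ᵐ x ∂μ, |x| ≤ R) (φ : smoothFunctions) : MemLp (φ : ℝ → ℝ) 2 μ :=
  memLp_two_of_continuous hb (contDiff_smoothFunctions φ).continuous

theorem memLp_deriv_smoothFunctions {μ : Measure ℝ} [IsFiniteMeasure μ] {R : ℝ}
    (hb : ∀ᵐ x ∂μ, |x| ≤ R) (φ : smoothFunctions) : MemLp (deriv (φ : ℝ → ℝ)) 2 μ :=
  memLp_two_of_continuous hb (continuous_deriv_smoothFunctions φ)

/-- The linear map `φ ↦ (φ, φ')` from the smooth functions to `L²_μ × L²_μ`. -/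
noncomputable def smoothJet {μ : Measure ℝ} [IsFiniteMeasure μ] {R : ℝ}
    (hb : ∀ᵐ x ∂μ, |x| ≤ R) : smoothFunctions →ₗ[ℝ] Lp ℝ 2 μ × Lp ℝ 2 μ where
  toFun φ := ((memLp_smoothFunctions hb φ).toLp _, (memLp_deriv_smoothFunctions hb φ).toLp _)
  map_add' φ ψ := by
    refine Prod.ext (MemLp.toLp_add (memLp_smoothFunctions hb φ) (memLp_smoothFunctions hb ψ)) ?_
    refine (MemLp.toLp_congr (memLp_deriv_smoothFunctions hb (φ + ψ))
      ((memLp_deriv_smoothFunctions hb φ).add (memLp_deriv_smoothFunctions hb ψ)) ?_).trans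
        (MemLp.toLp_add (memLp_deriv_smoothFunctions hb φ) (memLp_deriv_smoothFunctions hb ψ))
    exact Eventually.of_forall fun x =>
      deriv_add (differentiable_smoothFunctions φ x) (differentiable_smoothFunctions ψ x)
  map_smul' c φ := by
    refine Prod.ext (MemLp.toLp_const_smul c (memLp_smoothFunctions hb φ)) ?_
    refine (MemLp.toLp_congr (memLp_deriv_smoothFunctions hb (c • φ))
      ((memLp_deriv_smoothFunctions hb φ).const_smul c) ?_).trans
        (MemLp.toLp_const_smul c (memLp_deriv_smoothFunctions hb φ))
    exact Eventually.of_forall fun x => deriv_const_smul c (differentiable_smoothFunctions φ x)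

theorem smoothJet_fst_ae {μ : Measure ℝ} [IsFiniteMeasure μ] {R : ℝ} (hb : ∀ᵐ x ∂μ, |x| ≤ R)
    (φ : smoothFunctions) : (smoothJet hb φ).1 =ᵐ[μ] φ :=
  (memLp_smoothFunctions hb φ).coeFn_toLp

theorem smoothJet_snd_ae {μ : Measure ℝ} [IsFiniteMeasure μ] {R : ℝ} (hb : ∀ᵐ x ∂μ, |x| ≤ R)
    (φ : smoothFunctions) : (smoothJet hb φ).2 =ᵐ[μ] deriv φ :=
  (memLp_deriv_smoothFunctions hb φ).coeFn_toLp

/-- The `L²_μ`-seminorm of the derivative. -/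
noncomputable def derivNorm (μ : Measure ℝ) (φ : ℝ → ℝ) : ℝ := (eLpNorm (deriv φ) 2 μ).toReal

theorem derivNorm_nonneg (μ : Measure ℝ) (φ : ℝ → ℝ) : 0 ≤ derivNorm μ φ := ENNReal.toReal_nonneg

section

variable {μ : Measure ℝ} [IsFiniteMeasure μ] {R : ℝ} (hb : ∀ᵐ x ∂μ, |x| ≤ R)

theorem norm_smoothJet_snd (φ : smoothFunctions) : ‖(smoothJet hb φ).2‖ = derivNorm μ φ :=
  Lp.norm_toLp _ (memLp_deriv_smoothFunctions hb φ)

theorem derivNorm_le (hb : ∀ᵐ x ∂μ, |x| ≤ R) {f g : ℝ → ℝ} {c : ℝ} (hc : 0 ≤ c)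
    (hg : ContDiff ℝ ∞ g) (h : ∀ᵐ t ∂μ, |deriv f t| ≤ c * |deriv g t|) :
    derivNorm μ f ≤ c * derivNorm μ g := by
  have h1 := eLpNorm_le_mul_eLpNorm_of_ae_le_mul (f := deriv f) (g := deriv g) h 2
  have h2 := ENNReal.toReal_mono (ENNReal.mul_ne_top ENNReal.ofReal_ne_top
    (memLp_two_of_continuous hb (hg.continuous_deriv (by simp))).eLpNorm_ne_top) h1
  rwa [ENNReal.toReal_mul, ENNReal.toReal_ofReal hc] at h2

theorem smoothGraph_eq_range : smoothGraph μ = (LinearMap.range (smoothJet hb) : Set _) := by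
  ext ⟨u, v⟩
  constructor
  · rintro ⟨φ, hφ, hu, hv⟩
    exact ⟨⟨φ, hφ⟩, Prod.ext (Lp.ext ((smoothJet_fst_ae hb _).trans hu.symm))
      (Lp.ext ((smoothJet_snd_ae hb _).trans hv.symm))⟩
  · rintro ⟨φ, hφ⟩
    rw [← hφ]
    exact ⟨φ, contDiff_smoothFunctions φ, smoothJet_fst_ae hb φ, smoothJet_snd_ae hb φ⟩

/-- The closure of the graph of the derivative. -/
noncomputable def sobolevGraph : Submodule ℝ (Lp ℝ 2 μ × Lp ℝ 2 μ) :=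
  (LinearMap.range (smoothJet hb)).topologicalClosure

theorem isClosed_sobolevGraph : IsClosed (sobolevGraph hb : Set (Lp ℝ 2 μ × Lp ℝ 2 μ)) :=
  Submodule.isClosed_topologicalClosure _

theorem mem_gradients_iff_mem_sobolevGraph {u v : Lp ℝ 2 μ} :
    v ∈ gradients μ u ↔ (u, v) ∈ sobolevGraph hb := by
  rw [mem_gradients_iff_closure, smoothGraph_eq_range hb]
  rfl

theorem mem_sobolevGraph_of_tendsto {φ : ℕ → smoothFunctions} {p : Lp ℝ 2 μ × Lp ℝ 2 μ}
    (h : Tendsto (fun n => smoothJet hb (φ n)) atTop (𝓝 p)) : p ∈ sobolevGraph hb :=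
  mem_closure_of_tendsto h (Eventually.of_forall fun n => ⟨φ n, rfl⟩)

/-- The functions that admit `0` as a gradient. -/
noncomputable def flatFunctions : Submodule ℝ (Lp ℝ 2 μ) :=
  (sobolevGraph hb).comap (LinearMap.inl ℝ _ _)

theorem mem_flatFunctions {u : Lp ℝ 2 μ} : u ∈ flatFunctions hb ↔ (u, 0) ∈ sobolevGraph hb :=
  Iff.rfl

theorem isClosed_flatFunctions : IsClosed (flatFunctions hb : Set (Lp ℝ 2 μ)) :=
  (isClosed_sobolevGraph hb).preimage (f := fun u : Lp ℝ 2 μ => (u, (0 : Lp ℝ 2 μ)))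
    (by fun_prop)

/-- A pointwise limit of smooth functions with values in `[0, 1]` whose derivatives tend to `0`
in `L²_μ` admits `0` as a gradient. -/
theorem indicator_mem_flatFunctions {f : ℕ → ℝ → ℝ} {s : Set ℝ} (hs : MeasurableSet s)
    (hf : ∀ n, ContDiff ℝ ∞ (f n)) (h01 : ∀ n t, f n t ∈ Set.Icc (0 : ℝ) 1)
    (hlim : ∀ t, Tendsto (fun n => f n t) atTop (𝓝 (s.indicator (fun _ => (1 : ℝ)) t)))
    (hd : Tendsto (fun n => derivNorm μ (f n)) atTop (𝓝 0)) :
    indicatorConstLp 2 hs (measure_ne_top μ s) (1 : ℝ) ∈ flatFunctions hb := by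
  rw [mem_flatFunctions]
  refine mem_sobolevGraph_of_tendsto hb (φ := fun n => ⟨f n, hf n⟩) ?_
  refine Tendsto.prodMk_nhds ?_ ?_
  · refine (Lp.tendsto_Lp_iff_tendsto_eLpNorm'' _ _ _ _).2 ?_
    have h1 : Tendsto (fun n => ∫⁻ t, ‖(f n - s.indicator fun _ => (1 : ℝ)) t‖ₑ ^ (2 : ℝ) ∂μ)
        atTop (𝓝 (∫⁻ _, 0 ∂μ)) := by
      refine tendsto_lintegral_of_dominated_convergence (fun _ => 1) ?_ ?_ ?_ ?_
      · intro n
        exact (((hf n).continuous.measurable.sub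
          (measurable_const.indicator hs)).enorm).pow_const _
      · intro n
        refine Eventually.of_forall fun t => ?_
        refine ENNReal.rpow_le_one ?_ (by norm_num)
        rw [← ofReal_norm, ENNReal.ofReal_le_one, Real.norm_eq_abs, Pi.sub_apply, abs_le]
        have h2 := h01 n t
        by_cases ht : t ∈ s
        · rw [Set.indicator_of_mem ht]
          constructor <;> linarith [h2.1, h2.2]
        · rw [Set.indicator_of_notMem ht]
          constructor <;> linarith [h2.1, h2.2]
      · simp
      · refine Eventually.of_forall fun t => ?_
        have h2 : Tendsto (fun n => (f n - s.indicator fun _ => (1 : ℝ)) t) atTop (𝓝 0) := by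
          have := (hlim t).sub_const (s.indicator (fun _ => (1 : ℝ)) t)
          rwa [sub_self] at this
        have h3 := (h2.enorm).ennrpow_const 2
        simpa using h3
    have h2 := h1.ennrpow_const (1 / 2)
    simp only [eLpNorm_eq_lintegral_rpow_enorm_toReal (p := 2) two_ne_zero ENNReal.ofNat_ne_top,
      ENNReal.toReal_ofNat]
    simpa using h2
  · rw [tendsto_zero_iff_norm_tendsto_zero]
    refine hd.congr fun n => ?_
    exact (norm_smoothJet_snd hb ⟨f n, hf n⟩).symm

end

/-- Two points are linked if the increment of smooth functions between them is controlled by the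
`L²_μ`-seminorm of the derivative. -/
def Linked (μ : Measure ℝ) (x y : ℝ) : Prop :=
  ∃ C : ℝ, 0 < C ∧ ∀ φ : ℝ → ℝ, ContDiff ℝ ∞ φ → |φ x - φ y| ≤ C * derivNorm μ φ

namespace Linked

variable {μ : Measure ℝ} {x y z : ℝ}

theorem refl (μ : Measure ℝ) (x : ℝ) : Linked μ x x :=
  ⟨1, one_pos, fun φ _ => by simpa using derivNorm_nonneg μ φ⟩

theorem symm (h : Linked μ x y) : Linked μ y x := by
  obtain ⟨C, hC, h⟩ := h
  exact ⟨C, hC, fun φ hφ => abs_sub_comm (φ y) (φ x) ▸ h φ hφ⟩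

theorem trans (h : Linked μ x y) (h' : Linked μ y z) : Linked μ x z := by
  obtain ⟨C, hC, h⟩ := h
  obtain ⟨C', hC', h'⟩ := h'
  refine ⟨C + C', by positivity, fun φ hφ => ?_⟩
  calc |φ x - φ z| ≤ |φ x - φ y| + |φ y - φ z| := abs_sub_le _ _ _
    _ ≤ C * derivNorm μ φ + C' * derivNorm μ φ := add_le_add (h φ hφ) (h' φ hφ)
    _ = _ := by ring

/-- If `x` and `y` are linked then so are all the points between them, uniformly. -/
theorem exists_bound [IsFiniteMeasure μ] {R : ℝ} (hb : ∀ᵐ x ∂μ, |x| ≤ R) (h : Linked μ x y) :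
    ∃ C : ℝ, 0 < C ∧ ∀ φ : ℝ → ℝ, ContDiff ℝ ∞ φ → ∀ z ∈ Set.Icc x y,
      |φ x - φ z| ≤ C * derivNorm μ φ := by
  obtain ⟨K, hK, htr⟩ := exists_truncation
  obtain ⟨C, hC, h⟩ := h
  refine ⟨C * K, by positivity, fun φ hφ z hz => ?_⟩
  by_cases hne : φ x = φ z
  · rw [hne, sub_self, abs_zero]
    have := derivNorm_nonneg μ φ
    positivity
  have hxz : x < z := lt_of_le_of_ne hz.1 (fun h => hne (by rw [h]))
  obtain ⟨f, hf, hf0, hf1, -, hfd⟩ := htr φ x z hφ hxz hne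
  have hpos : 0 < |φ x - φ z| := abs_pos.2 (sub_ne_zero.2 hne)
  have h1 := h f hf
  rw [hf0 x le_rfl, hf1 y hz.2, zero_sub, abs_neg, abs_one] at h1
  have h2 := derivNorm_le hb (by positivity) hφ (Eventually.of_forall hfd)
  have h3 : 1 ≤ C * (K / |φ x - φ z| * derivNorm μ φ) :=
    h1.trans (mul_le_mul_of_nonneg_left h2 hC.le)
  calc |φ x - φ z| = |φ x - φ z| * 1 := (mul_one _).symm
    _ ≤ |φ x - φ z| * (C * (K / |φ x - φ z| * derivNorm μ φ)) := by gcongr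
    _ = _ := by field_simp

theorem of_mem_Icc [IsFiniteMeasure μ] {R : ℝ} (hb : ∀ᵐ x ∂μ, |x| ≤ R) (h : Linked μ x y)
    (hz : z ∈ Set.Icc x y) : Linked μ x z := by
  obtain ⟨C, hC, h⟩ := h.exists_bound hb
  exact ⟨C, hC, fun φ hφ => h φ hφ z hz⟩

theorem measure_Icc_pos [IsFiniteMeasure μ] {R : ℝ} (hb : ∀ᵐ x ∂μ, |x| ≤ R) (h : Linked μ x y)
    (hxy : x < y) : 0 < μ (Set.Icc x y) := by
  by_contra h0
  rw [not_lt, nonpos_iff_eq_zero] at h0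
  obtain ⟨K, hK, htr⟩ := exists_truncation
  obtain ⟨C, hC, h⟩ := h
  obtain ⟨f, hf, hf0, hf1, -, -⟩ := htr id x y contDiff_id hxy hxy.ne
  have h1 := h f hf
  rw [hf0 x le_rfl, hf1 y le_rfl, zero_sub, abs_neg, abs_one] at h1
  have h2 : derivNorm μ f ≤ 0 * derivNorm μ f := by
    refine derivNorm_le hb le_rfl hf ?_
    have h3 : ∀ᵐ t ∂μ, t ∉ Set.Icc x y := measure_eq_zero_iff_ae_notMem.1 h0
    filter_upwards [h3] with t ht
    rw [Set.mem_Icc, not_and_or, not_le, not_le] at ht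
    have hd : deriv f t = 0 := by
      rcases ht with ht | ht
      · have : f =ᶠ[𝓝 t] fun _ => 0 := by
          filter_upwards [Iio_mem_nhds ht] with r hr
          exact hf0 r (le_of_lt hr)
        rw [this.deriv_eq, deriv_const]
      · have : f =ᶠ[𝓝 t] fun _ => 1 := by
          filter_upwards [Ioi_mem_nhds ht] with r hr
          exact hf1 r (le_of_lt hr)
        rw [this.deriv_eq, deriv_const]
    rw [hd, abs_zero, zero_mul]
  rw [zero_mul] at h2
  nlinarith

end Linked

section

variable {μ : Measure ℝ} [IsFiniteMeasure μ] {R : ℝ} (hb : ∀ᵐ x ∂μ, |x| ≤ R)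

theorem exists_smooth_jump (hb : ∀ᵐ x ∂μ, |x| ≤ R) {x y : ℝ} (hxy : x < y)
    (h : ¬ Linked μ x y) {ε : ℝ} (hε : 0 < ε) :
    ∃ f : ℝ → ℝ, ContDiff ℝ ∞ f ∧ (∀ t ≤ x, f t = 0) ∧ (∀ t, y ≤ t → f t = 1) ∧
      (∀ t, f t ∈ Set.Icc (0 : ℝ) 1) ∧ derivNorm μ f ≤ ε := by
  obtain ⟨K, hK, htr⟩ := exists_truncation
  simp only [Linked, not_exists, not_and, not_forall, not_le] at h
  obtain ⟨φ, hφ, hlt⟩ := h (K / ε) (by positivity)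
  have hpos : 0 < |φ x - φ y| := lt_of_le_of_lt (by have := derivNorm_nonneg μ φ; positivity) hlt
  obtain ⟨f, hf, hf0, hf1, hf01, hfd⟩ := htr φ x y hφ hxy (sub_ne_zero.1 (abs_pos.1 hpos))
  refine ⟨f, hf, hf0, hf1, hf01, ?_⟩
  refine (derivNorm_le hb (by positivity) hφ (Eventually.of_forall hfd)).trans ?_
  rw [div_mul_eq_mul_div, div_le_iff₀ hpos]
  rw [div_mul_eq_mul_div, div_lt_iff₀ hε] at hlt
  linarith

theorem indicator_Ioi_mem_flatFunctions {x : ℝ} (h : ∀ y, x < y → ¬ Linked μ x y) :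
    indicatorConstLp 2 measurableSet_Ioi (measure_ne_top μ (Set.Ioi x)) (1 : ℝ) ∈
      flatFunctions hb := by
  have hpos : ∀ n : ℕ, (0 : ℝ) < 1 / ((n : ℝ) + 1) := fun n => Nat.one_div_pos_of_nat
  choose f hf hf0 hf1 hf01 hfd using fun n : ℕ =>
    exists_smooth_jump hb (lt_add_of_pos_right x (hpos n)) (h _ (lt_add_of_pos_right x (hpos n)))
      (hpos n)
  refine indicator_mem_flatFunctions hb measurableSet_Ioi hf hf01 ?_ ?_
  · intro t
    by_cases ht : x < t
    · rw [Set.indicator_of_mem (Set.mem_Ioi.2 ht)]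
      refine tendsto_const_nhds.congr' ?_
      have h1 := (tendsto_one_div_add_atTop_nhds_zero_nat (𝕜 := ℝ)).eventually_lt_const
        (sub_pos.2 ht)
      filter_upwards [h1] with n hn
      exact (hf1 n t (by linarith)).symm
    · rw [Set.indicator_of_notMem (by simpa using ht)]
      refine tendsto_const_nhds.congr fun n => ?_
      exact (hf0 n t (not_lt.1 ht)).symm
  · exact squeeze_zero (fun n => derivNorm_nonneg _ _) hfd
      tendsto_one_div_add_atTop_nhds_zero_nat

theorem indicator_Ici_mem_flatFunctions {x : ℝ} (h : ∀ y, y < x → ¬ Linked μ y x) :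
    indicatorConstLp 2 measurableSet_Ici (measure_ne_top μ (Set.Ici x)) (1 : ℝ) ∈
      flatFunctions hb := by
  have hpos : ∀ n : ℕ, (0 : ℝ) < 1 / ((n : ℝ) + 1) := fun n => Nat.one_div_pos_of_nat
  choose f hf hf0 hf1 hf01 hfd using fun n : ℕ =>
    exists_smooth_jump hb (sub_lt_self x (hpos n)) (h _ (sub_lt_self x (hpos n))) (hpos n)
  refine indicator_mem_flatFunctions hb measurableSet_Ici hf hf01 ?_ ?_
  · intro t
    by_cases ht : x ≤ t
    · rw [Set.indicator_of_mem (Set.mem_Ici.2 ht)]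
      refine tendsto_const_nhds.congr fun n => ?_
      exact (hf1 n t ht).symm
    · rw [Set.indicator_of_notMem (by simpa using ht)]
      refine tendsto_const_nhds.congr' ?_
      have h1 := (tendsto_one_div_add_atTop_nhds_zero_nat (𝕜 := ℝ)).eventually_lt_const
        (sub_pos.2 (not_le.1 ht))
      filter_upwards [h1] with n hn
      exact (hf0 n t (by linarith)).symm
  · exact squeeze_zero (fun n => derivNorm_nonneg _ _) hfd
      tendsto_one_div_add_atTop_nhds_zero_nat

theorem indicator_univ_mem_flatFunctions :
    indicatorConstLp 2 MeasurableSet.univ (measure_ne_top μ Set.univ) (1 : ℝ) ∈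
      flatFunctions hb := by
  refine indicator_mem_flatFunctions hb MeasurableSet.univ (f := fun _ _ => 1)
    (fun _ => contDiff_const) (fun _ _ => by simp) (fun t => by simp) ?_
  simp [derivNorm]

end

section

variable {μ : Measure ℝ} [IsFiniteMeasure μ] {R : ℝ} {hb : ∀ᵐ x ∂μ, |x| ≤ R}

theorem setIntegral_eq_zero_of_mem_orthogonal {w : Lp ℝ 2 μ} (hw : w ∈ (flatFunctions hb)ᗮ)
    {s : Set ℝ} (hs : MeasurableSet s)
    (h : indicatorConstLp 2 hs (measure_ne_top μ s) (1 : ℝ) ∈ flatFunctions hb) :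
    ∫ x in s, w x ∂μ = 0 := by
  rw [← L2.inner_indicatorConstLp_one (𝕜 := ℝ) hs (measure_ne_top μ s)]
  exact (Submodule.mem_orthogonal _ _).1 hw _ h

theorem integrable_of_Lp_two (w : Lp ℝ 2 μ) : Integrable w μ :=
  (Lp.memLp w).integrable (by norm_num)

theorem setIntegral_lowerSet_eq_zero {w : Lp ℝ 2 μ} (hw : w ∈ (flatFunctions hb)ᗮ) {A : Set ℝ}
    (hA : IsLowerSet A) (hlink : ∀ x ∈ A, ∀ y ∉ A, ¬ Linked μ x y) :
    ∫ x in A, w x ∂μ = 0 := by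
  have huniv : ∫ x, w x ∂μ = 0 := by
    rw [← setIntegral_univ]
    exact setIntegral_eq_zero_of_mem_orthogonal hw _ (indicator_univ_mem_flatFunctions hb)
  have hcompl : ∀ s : Set ℝ, MeasurableSet s → ∫ x in sᶜ, w x ∂μ = 0 →
      ∫ x in s, w x ∂μ = 0 := by
    intro s hs h
    have := integral_add_compl hs (integrable_of_Lp_two w)
    rwa [h, huniv, add_zero] at this
  rcases A.eq_empty_or_nonempty with rfl | hne
  · simp
  by_cases hbdd : BddAbove A
  · by_cases hmem : sSup A ∈ A
    · have hAe : A = Set.Iic (sSup A) :=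
        Set.Subset.antisymm (fun x hx => le_csSup hbdd hx) (fun x hx => hA hx hmem)
      rw [hAe]
      refine hcompl _ measurableSet_Iic ?_
      rw [Set.compl_Iic]
      refine setIntegral_eq_zero_of_mem_orthogonal hw measurableSet_Ioi
        (indicator_Ioi_mem_flatFunctions hb fun y hy => hlink _ hmem y fun hyA => ?_)
      exact absurd (le_csSup hbdd hyA) (not_le.2 hy)
    · have hAe : A = Set.Iio (sSup A) := by
        refine Set.Subset.antisymm (fun x hx => lt_of_le_of_ne (le_csSup hbdd hx) ?_) ?_
        · rintro rfl
          exact hmem hx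
        · intro x hx
          obtain ⟨z, hz, hxz⟩ := exists_lt_of_lt_csSup hne hx
          exact hA hxz.le hz
      have hlt : ∀ y, y < sSup A → y ∈ A := fun y hy => by
        rw [hAe]
        exact hy
      have h1 : ∫ x in Set.Iio (sSup A), w x ∂μ = 0 := by
        refine hcompl _ measurableSet_Iio ?_
        rw [Set.compl_Iio]
        exact setIntegral_eq_zero_of_mem_orthogonal hw measurableSet_Ici
          (indicator_Ici_mem_flatFunctions hb fun y hy => hlink _ (hlt y hy) _ hmem)
      rwa [← hAe] at h1
  · have hAe : A = Set.univ := by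
      refine Set.eq_univ_of_forall fun x => ?_
      obtain ⟨z, hz, hxz⟩ := not_bddAbove_iff.1 hbdd x
      exact hA hxz.le hz
    rw [hAe, setIntegral_univ, huniv]

end

/-- The points linked to `s`. -/
def linkedClass (μ : Measure ℝ) (s : ℝ) : Set ℝ := {x | Linked μ s x}

theorem mem_linkedClass {μ : Measure ℝ} {s x : ℝ} : x ∈ linkedClass μ s ↔ Linked μ s x := Iff.rfl

/-- The points of `(-∞, t)` that are not linked to `t`. -/
def unlinkedBelow (μ : Measure ℝ) (t : ℝ) : Set ℝ := {x | x < t ∧ ¬ Linked μ x t}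

theorem disjoint_unlinkedBelow_linkedClass (μ : Measure ℝ) (t : ℝ) :
    Disjoint (unlinkedBelow μ t) (linkedClass μ t) := by
  rw [Set.disjoint_left]
  exact fun x hx hx' => hx.2 (Linked.symm hx')

/-- The points that are linked to no element of a countable set. -/
def unlinkedSet (μ : Measure ℝ) (e : ℕ → ℝ) : Set ℝ := (⋃ n, linkedClass μ (e n))ᶜ

theorem mem_unlinkedSet {μ : Measure ℝ} {e : ℕ → ℝ} {x : ℝ} :
    x ∈ unlinkedSet μ e ↔ ∀ n, ¬ Linked μ (e n) x := by
  simp [unlinkedSet, mem_linkedClass]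

section

variable {μ : Measure ℝ} [IsFiniteMeasure μ] {R : ℝ}

theorem Linked.of_mem_Icc' (hb : ∀ᵐ x ∂μ, |x| ≤ R) {x y z : ℝ} (h : Linked μ x y)
    (hz : z ∈ Set.Icc x y) : Linked μ z y :=
  (h.of_mem_Icc hb hz).symm.trans h

theorem isLowerSet_unlinkedBelow (hb : ∀ᵐ x ∂μ, |x| ≤ R) (t : ℝ) :
    IsLowerSet (unlinkedBelow μ t) := by
  rintro x y hyx ⟨hxt, hx⟩
  exact ⟨hyx.trans_lt hxt, fun h => hx (h.of_mem_Icc' hb ⟨hyx, hxt.le⟩)⟩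

theorem mem_unlinkedBelow_of_linked (hb : ∀ᵐ x ∂μ, |x| ≤ R) {t x y : ℝ}
    (hx : x ∈ unlinkedBelow μ t) (h : Linked μ x y) : y ∈ unlinkedBelow μ t := by
  obtain ⟨hxt, hx⟩ := hx
  refine ⟨?_, fun h' => hx (h.trans h')⟩
  by_contra hty
  exact hx (h.of_mem_Icc hb ⟨hxt.le, not_lt.1 hty⟩)

theorem isLowerSet_unlinkedBelow_union (hb : ∀ᵐ x ∂μ, |x| ≤ R) (t : ℝ) :
    IsLowerSet (unlinkedBelow μ t ∪ linkedClass μ t) := by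
  rintro x y hyx (hx | hx)
  · exact Or.inl (isLowerSet_unlinkedBelow hb t hyx hx)
  · by_cases hy : Linked μ t y
    · exact Or.inr hy
    · refine Or.inl ⟨?_, fun h => hy h.symm⟩
      by_contra hty
      exact hy (hx.of_mem_Icc hb ⟨not_lt.1 hty, hyx⟩)

theorem measurableSet_unlinkedBelow (hb : ∀ᵐ x ∂μ, |x| ≤ R) (t : ℝ) :
    MeasurableSet (unlinkedBelow μ t) :=
  (isLowerSet_unlinkedBelow hb t).ordConnected.measurableSet

theorem measurableSet_linkedClass (hb : ∀ᵐ x ∂μ, |x| ≤ R) (t : ℝ) :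
    MeasurableSet (linkedClass μ t) := by
  have h : linkedClass μ t = (unlinkedBelow μ t ∪ linkedClass μ t) \ unlinkedBelow μ t := by
    rw [Set.union_sdiff_left, (disjoint_unlinkedBelow_linkedClass μ t).symm.sdiff_eq_left]
  rw [h]
  exact (isLowerSet_unlinkedBelow_union hb t).ordConnected.measurableSet.diff
    (measurableSet_unlinkedBelow hb t)

variable {hb : ∀ᵐ x ∂μ, |x| ≤ R}

theorem setIntegral_unlinkedBelow {w : Lp ℝ 2 μ} (hw : w ∈ (flatFunctions hb)ᗮ) (t : ℝ) :
    ∫ x in unlinkedBelow μ t, w x ∂μ = 0 :=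
  setIntegral_lowerSet_eq_zero hw (isLowerSet_unlinkedBelow hb t) fun _ hx _ hy h =>
    hy (mem_unlinkedBelow_of_linked hb hx h)

theorem setIntegral_linkedClass {w : Lp ℝ 2 μ} (hw : w ∈ (flatFunctions hb)ᗮ) (t : ℝ) :
    ∫ x in linkedClass μ t, w x ∂μ = 0 := by
  have h1 : ∫ x in unlinkedBelow μ t ∪ linkedClass μ t, w x ∂μ = 0 := by
    refine setIntegral_lowerSet_eq_zero hw (isLowerSet_unlinkedBelow_union hb t) ?_
    rintro x (hx | hx) y hy h
    · exact hy (Or.inl (mem_unlinkedBelow_of_linked hb hx h))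
    · exact hy (Or.inr (Linked.trans hx h))
  rwa [setIntegral_union (disjoint_unlinkedBelow_linkedClass μ t) (measurableSet_linkedClass hb t)
    (integrable_of_Lp_two w).integrableOn (integrable_of_Lp_two w).integrableOn,
    setIntegral_unlinkedBelow hw, zero_add] at h1

theorem setIntegral_unlinkedBelow_diff {w : Lp ℝ 2 μ} (hw : w ∈ (flatFunctions hb)ᗮ) (t : ℝ)
    (e : ℕ → ℝ) : ∫ x in unlinkedBelow μ t \ ⋃ n, linkedClass μ (e n), w x ∂μ = 0 := by
  let A : ℕ → Set ℝ := fun n => unlinkedBelow μ t \ ⋃ i < n, linkedClass μ (e i)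
  have hmem : ∀ n x, x ∈ A n ↔ x ∈ unlinkedBelow μ t ∧ ∀ i < n, ¬ Linked μ (e i) x := by
    intro n x
    simp [A, mem_linkedClass]
  have hmeas : ∀ n, MeasurableSet (A n) := fun n =>
    (measurableSet_unlinkedBelow hb t).diff
      (MeasurableSet.iUnion fun i => MeasurableSet.iUnion fun _ => measurableSet_linkedClass hb _)
  have hint : ∀ n, ∫ x in A n, w x ∂μ = 0 := by
    intro n
    induction n with
    | zero => simpa [A] using setIntegral_unlinkedBelow hw t
    | succ n ih =>
      have hsucc : A (n + 1) = A n \ linkedClass μ (e n) := by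
        ext x
        rw [hmem, Set.mem_sdiff, hmem, mem_linkedClass, Nat.forall_lt_succ_right, and_assoc]
      by_cases hn : e n ∈ A n
      · have hsub : linkedClass μ (e n) ⊆ A n := by
          intro x hx
          rw [hmem] at hn ⊢
          exact ⟨mem_unlinkedBelow_of_linked hb hn.1 hx,
            fun i hi h => hn.2 i hi (h.trans (Linked.symm hx))⟩
        rw [hsucc, setIntegral_sdiff (measurableSet_linkedClass hb _)
          (integrable_of_Lp_two w).integrableOn hsub, ih, setIntegral_linkedClass hw, sub_zero]
      · have hdisj : Disjoint (A n) (linkedClass μ (e n)) := by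
          rw [Set.disjoint_left]
          intro x hx hx'
          apply hn
          rw [hmem] at hx ⊢
          exact ⟨mem_unlinkedBelow_of_linked hb hx.1 (Linked.symm hx'),
            fun i hi h => hx.2 i hi (h.trans hx')⟩
        rw [hsucc, hdisj.sdiff_eq_left, ih]
  have hanti : Antitone A := by
    intro m n hmn x hx
    rw [hmem] at hx ⊢
    exact ⟨hx.1, fun i hi => hx.2 i (hi.trans_le hmn)⟩
  have hinter : unlinkedBelow μ t \ ⋃ n, linkedClass μ (e n) = ⋂ n, A n := by
    ext x
    simp only [Set.mem_sdiff, Set.mem_iUnion, Set.mem_iInter, hmem, mem_linkedClass, not_exists]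
    exact ⟨fun h n => ⟨h.1, fun i _ => h.2 i⟩,
      fun h => ⟨(h 0).1, fun i => (h (i + 1)).2 i (Nat.lt_succ_self i)⟩⟩
  rw [hinter]
  have hlim := tendsto_setIntegral_of_antitone (μ := μ) hmeas hanti
    ⟨0, (integrable_of_Lp_two w).integrableOn⟩
  simp only [hint] at hlim
  exact (tendsto_nhds_unique tendsto_const_nhds hlim).symm

theorem measurableSet_unlinkedSet (hb : ∀ᵐ x ∂μ, |x| ≤ R) (e : ℕ → ℝ) :
    MeasurableSet (unlinkedSet μ e) :=
  (MeasurableSet.iUnion fun _ => measurableSet_linkedClass hb _).compl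

theorem ae_eq_zero_of_mem_orthogonal {w : Lp ℝ 2 μ} (hw : w ∈ (flatFunctions hb)ᗮ) {e : ℕ → ℝ}
    (he : ∀ q : ℚ, ∃ n, e n = q) : ∀ᵐ x ∂μ, x ∈ unlinkedSet μ e → w x = 0 := by
  have hB := measurableSet_unlinkedSet hb e
  have hwi := integrable_of_Lp_two w
  have hIio : ∀ t, ∫ x in unlinkedSet μ e ∩ Set.Iio t, w x ∂μ = 0 := by
    intro t
    have h1 : unlinkedSet μ e ∩ Set.Iio t = unlinkedBelow μ t \ ⋃ n, linkedClass μ (e n) := by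
      ext x
      constructor
      · rintro ⟨hx, hxt⟩
        refine ⟨⟨hxt, fun h => ?_⟩, hx⟩
        obtain ⟨q, hxq, hqt⟩ := exists_rat_btwn (Set.mem_Iio.1 hxt)
        obtain ⟨n, hn⟩ := he q
        refine mem_unlinkedSet.1 hx n ?_
        rw [hn]
        exact (h.of_mem_Icc hb ⟨hxq.le, hqt.le⟩).symm
      · rintro ⟨hx, hx'⟩
        exact ⟨hx', hx.1⟩
    rw [h1, setIntegral_unlinkedBelow_diff hw]
  have huniv : ∫ x in unlinkedSet μ e, w x ∂μ = 0 := by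
    have hlim := tendsto_setIntegral_of_monotone (μ := μ) (f := w)
      (s := fun n : ℕ => unlinkedSet μ e ∩ Set.Iio (n : ℝ))
      (fun n => hB.inter measurableSet_Iio)
      (fun m n hmn => Set.inter_subset_inter_right _
        (Set.Iio_subset_Iio (Nat.cast_le.2 hmn))) hwi.integrableOn
    have hU : ⋃ n : ℕ, unlinkedSet μ e ∩ Set.Iio (n : ℝ) = unlinkedSet μ e := by
      rw [← Set.inter_iUnion, Set.inter_eq_left]
      intro x _
      obtain ⟨n, hn⟩ := exists_nat_gt x
      exact Set.mem_iUnion.2 ⟨n, hn⟩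
    simp only [hIio, hU] at hlim
    exact (tendsto_nhds_unique tendsto_const_nhds hlim).symm
  have hall : ∀ s, MeasurableSet s → ∫ x in unlinkedSet μ e ∩ s, w x ∂μ = 0 := by
    intro s hs
    refine MeasurableSpace.induction_on_inter
      (C := fun s _ => ∫ x in unlinkedSet μ e ∩ s, w x ∂μ = 0)
      ((BorelSpace.measurable_eq (α := ℝ)).trans (borel_eq_generateFrom_Iio ℝ)) isPiSystem_Iio
      ?_ ?_ ?_ ?_ s hs
    · simp
    · rintro _ ⟨t, rfl⟩
      exact hIio t
    · intro s hs h
      have h1 := integral_inter_add_sdiff (μ := μ) (s := unlinkedSet μ e) hs (f := w)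
        hwi.integrableOn
      rw [h, huniv, zero_add] at h1
      rwa [← Set.sdiff_eq]
    · intro f hd hf h
      rw [Set.inter_iUnion, integral_iUnion (fun i => hB.inter (hf i)) ?_ hwi.integrableOn]
      · simp [h]
      · exact fun i j hij => (hd hij).mono Set.inter_subset_right Set.inter_subset_right
  rw [← ae_restrict_iff' hB]
  refine ae_eq_zero_of_forall_setIntegral_eq_of_sigmaFinite (fun _ _ _ => ?_) fun s hs _ => ?_
  · exact hwi.restrict.integrableOn
  · rw [Measure.restrict_restrict hs, Set.inter_comm]
    exact hall s hs

/-- A square-integrable function that vanishes outside of the unlinked set admits `0` as a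
gradient. -/
theorem mem_flatFunctions_of_ae_eq_zero (hb : ∀ᵐ x ∂μ, |x| ≤ R) {e : ℕ → ℝ}
    (he : ∀ q : ℚ, ∃ n, e n = q) {g : Lp ℝ 2 μ}
    (hg : ∀ᵐ x ∂μ, x ∉ unlinkedSet μ e → g x = 0) : g ∈ flatFunctions hb := by
  have : CompleteSpace (flatFunctions hb) := (isClosed_flatFunctions hb).completeSpace_coe
  rw [← Submodule.orthogonal_orthogonal (flatFunctions hb), Submodule.mem_orthogonal]
  intro w hw
  rw [L2.inner_def]
  refine integral_eq_zero_of_ae ?_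
  filter_upwards [hg, ae_eq_zero_of_mem_orthogonal hw he] with x h1 h2
  by_cases hx : x ∈ unlinkedSet μ e
  · simp [h2 hx]
  · simp [h1 hx]

end

section

variable {μ : Measure ℝ} [IsFiniteMeasure μ] {R : ℝ} (hb : ∀ᵐ x ∂μ, |x| ≤ R)

/-- The evaluation of smooth functions at `x` is bounded with respect to the norm of the graph. -/
def BoundedEval (x : ℝ) : Prop :=
  ∃ C : ℝ, ∀ φ : smoothFunctions, |(φ : ℝ → ℝ) x| ≤ C * ‖smoothJet hb φ‖

theorem derivNorm_le_norm_smoothJet (φ : smoothFunctions) :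
    derivNorm μ φ ≤ ‖smoothJet hb φ‖ := by
  rw [← norm_smoothJet_snd hb]
  exact norm_snd_le _

theorem boundedEval_of_measure_pos {x C : ℝ} (hC : 0 ≤ C) {s : Set ℝ} (hs : MeasurableSet s)
    (hpos : 0 < μ s)
    (h : ∀ φ : ℝ → ℝ, ContDiff ℝ ∞ φ → ∀ z ∈ s, |φ x - φ z| ≤ C * derivNorm μ φ) :
    BoundedEval hb x := by
  have hm : 0 < μ.real s ^ (1 / (2 : ℝ≥0∞).toReal) :=
    Real.rpow_pos_of_pos (ENNReal.toReal_pos hpos.ne' (measure_ne_top _ _)) _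
  set m := μ.real s ^ (1 / (2 : ℝ≥0∞).toReal)
  refine ⟨C + 1 / m, fun φ => ?_⟩
  have hN := derivNorm_le_norm_smoothJet hb φ
  have hN1 : ‖(smoothJet hb φ).1‖ ≤ ‖smoothJet hb φ‖ := norm_fst_le _
  set c := |(φ : ℝ → ℝ) x| - C * derivNorm μ φ with hc
  have hle : c * m ≤ ‖smoothJet hb φ‖ := by
    by_cases hc0 : c ≤ 0
    · exact (mul_nonpos_of_nonpos_of_nonneg hc0 hm.le).trans (norm_nonneg _)
    have h1 : ‖indicatorConstLp 2 hs (measure_ne_top μ s) c‖ ≤ ‖(smoothJet hb φ).1‖ := by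
      refine Lp.norm_le_norm_of_ae_le ?_
      filter_upwards [indicatorConstLp_coeFn (p := 2) (hs := hs) (hμs := measure_ne_top μ s)
        (c := c), smoothJet_fst_ae hb φ] with z hz hz'
      rw [hz, hz']
      by_cases hzs : z ∈ s
      · rw [Set.indicator_of_mem hzs, Real.norm_eq_abs, Real.norm_eq_abs,
          abs_of_pos (not_le.1 hc0), hc]
        have h2 := h φ (contDiff_smoothFunctions φ) z hzs
        have h3 := abs_sub_abs_le_abs_sub ((φ : ℝ → ℝ) x) ((φ : ℝ → ℝ) z)
        linarith
      · rw [Set.indicator_of_notMem hzs, norm_zero]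
        exact norm_nonneg _
    rw [norm_indicatorConstLp two_ne_zero ENNReal.ofNat_ne_top, Real.norm_eq_abs,
      abs_of_pos (not_le.1 hc0)] at h1
    exact h1.trans hN1
  have h4 : c ≤ ‖smoothJet hb φ‖ / m := (le_div_iff₀ hm).2 hle
  have h5 : C * derivNorm μ φ ≤ C * ‖smoothJet hb φ‖ := mul_le_mul_of_nonneg_left hN hC
  calc |(φ : ℝ → ℝ) x| = c + C * derivNorm μ φ := by rw [hc]; ring
    _ ≤ ‖smoothJet hb φ‖ / m + C * ‖smoothJet hb φ‖ := add_le_add h4 h5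
    _ = _ := by ring

theorem boundedEval_of_measure_singleton_pos {x : ℝ} (hx : 0 < μ {x}) : BoundedEval hb x := by
  refine boundedEval_of_measure_pos hb zero_le_one (measurableSet_singleton x) hx ?_
  rintro φ - z rfl
  simpa using derivNorm_nonneg μ φ

theorem Linked.boundedEval {x y : ℝ} (h : Linked μ x y) (hne : x ≠ y) : BoundedEval hb x := by
  rcases lt_or_gt_of_ne hne with hlt | hlt
  · obtain ⟨C, hC, hbd⟩ := h.exists_bound hb
    exact boundedEval_of_measure_pos hb hC.le measurableSet_Icc (h.measure_Icc_pos hb hlt) hbd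
  · obtain ⟨C, hC, hbd⟩ := h.symm.exists_bound hb
    refine boundedEval_of_measure_pos hb (C := 2 * C) (by positivity) measurableSet_Icc
      (h.symm.measure_Icc_pos hb hlt) fun φ hφ z hz => ?_
    have h1 := hbd φ hφ z hz
    have h2 := hbd φ hφ x ⟨hlt.le, le_rfl⟩
    rw [abs_sub_comm] at h2
    linarith [abs_sub_le (φ x) (φ y) (φ z)]

theorem ae_boundedEval (e : ℕ → ℝ) : ∀ᵐ x ∂μ, x ∉ unlinkedSet μ e → BoundedEval hb x := by
  have h0 : μ {x | x ∈ Set.range e ∧ μ {x} = 0} = 0 := by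
    have hc : {x | x ∈ Set.range e ∧ μ {x} = 0}.Countable :=
      (Set.countable_range e).mono fun x hx => hx.1
    rw [← Set.biUnion_of_singleton {x | x ∈ Set.range e ∧ μ {x} = 0}, measure_biUnion_null_iff hc]
    exact fun x hx => hx.2
  filter_upwards [measure_eq_zero_iff_ae_notMem.1 h0] with x hx hxe
  rw [mem_unlinkedSet, not_forall_not] at hxe
  obtain ⟨n, hn⟩ := hxe
  by_cases hne : x = e n
  · exact boundedEval_of_measure_singleton_pos hb
      (pos_iff_ne_zero.2 fun h => hx ⟨⟨n, hne.symm⟩, h⟩)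
  · exact hn.symm.boundedEval hb hne

/-- A bounded evaluation extends to a continuous functional on `L²_μ × L²_μ`. -/
theorem BoundedEval.exists_dual {x : ℝ} (h : BoundedEval hb x) :
    ∃ F : StrongDual ℝ (Lp ℝ 2 μ × Lp ℝ 2 μ),
      ∀ φ : smoothFunctions, F (smoothJet hb φ) = (φ : ℝ → ℝ) x := by
  obtain ⟨C, hC⟩ := h
  let ev : Module.Dual ℝ smoothFunctions := (LinearMap.proj x).comp smoothFunctions.subtype
  have hev : ∀ φ : smoothFunctions, ev φ = (φ : ℝ → ℝ) x := fun _ => rfl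
  have hmem : ev ∈ LinearMap.range (smoothJet hb).dualMap := by
    rw [LinearMap.range_dualMap_eq_dualAnnihilator_ker, Submodule.mem_dualAnnihilator]
    intro φ hφ
    have h1 := hC φ
    rw [LinearMap.mem_ker.1 hφ, norm_zero, mul_zero] at h1
    rw [hev]
    exact abs_nonpos_iff.1 h1
  obtain ⟨F₀, hF₀⟩ := hmem
  have hF : ∀ φ : smoothFunctions, F₀ (smoothJet hb φ) = (φ : ℝ → ℝ) x := fun φ => by
    rw [← hev, ← hF₀]
    rfl
  let F₁ : StrongDual ℝ (LinearMap.range (smoothJet hb)) :=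
    (F₀.comp (LinearMap.range (smoothJet hb)).subtype).mkContinuous C (by
      rintro ⟨_, φ, rfl⟩
      change |F₀ (smoothJet hb φ)| ≤ C * ‖smoothJet hb φ‖
      rw [hF]
      exact hC φ)
  obtain ⟨F, hFe, -⟩ := exists_extension_norm_eq _ F₁
  exact ⟨F, fun φ => (hFe ⟨_, φ, rfl⟩).trans (hF φ)⟩

theorem ae_eq_dual_of_mem_sobolevGraph {F : ℝ → StrongDual ℝ (Lp ℝ 2 μ × Lp ℝ 2 μ)} {s : Set ℝ}
    (hF : ∀ x ∈ s, ∀ φ : smoothFunctions, F x (smoothJet hb φ) = (φ : ℝ → ℝ) x)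
    {p : Lp ℝ 2 μ × Lp ℝ 2 μ} (hp : p ∈ sobolevGraph hb) :
    ∀ᵐ x ∂μ, x ∈ s → p.1 x = F x p := by
  obtain ⟨q, hq, hlim⟩ := mem_closure_iff_seq_limit.1 hp
  choose φ hφ using hq
  have h1 : Tendsto (fun n => (q n).1) atTop (𝓝 p.1) := (continuous_fst.tendsto _).comp hlim
  obtain ⟨σ, hσ, hae⟩ := (tendstoInMeasure_of_tendsto_Lp h1).exists_seq_tendsto_ae
  have h2 : ∀ᵐ x ∂μ, ∀ n, (q n).1 x = (φ n : ℝ → ℝ) x := by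
    refine ae_all_iff.2 fun n => ?_
    rw [← hφ n]
    exact smoothJet_fst_ae hb (φ n)
  filter_upwards [hae, h2] with x h3 h4 hx
  refine tendsto_nhds_unique h3 ?_
  have h5 := (((F x).continuous.tendsto p).comp hlim).comp hσ.tendsto_atTop
  refine h5.congr fun n => ?_
  simp only [Function.comp]
  rw [h4, ← hφ, hF x hx]

/-- Weak convergence in the graph implies convergence almost everywhere where evaluation is
bounded. -/
theorem ae_tendsto_of_tendsto_dual (e : ℕ → ℝ) {p : ℕ → Lp ℝ 2 μ × Lp ℝ 2 μ}
    {q : Lp ℝ 2 μ × Lp ℝ 2 μ} (hp : ∀ n, p n ∈ sobolevGraph hb) (hq : q ∈ sobolevGraph hb)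
    (h : ∀ F : StrongDual ℝ (Lp ℝ 2 μ × Lp ℝ 2 μ), Tendsto (fun n => F (p n)) atTop (𝓝 (F q))) :
    ∀ᵐ x ∂μ, x ∉ unlinkedSet μ e → Tendsto (fun n => (p n).1 x) atTop (𝓝 (q.1 x)) := by
  have hex : ∀ x, ∃ F : StrongDual ℝ (Lp ℝ 2 μ × Lp ℝ 2 μ), BoundedEval hb x →
      ∀ φ : smoothFunctions, F (smoothJet hb φ) = (φ : ℝ → ℝ) x := by
    intro x
    by_cases hx : BoundedEval hb x
    · exact (hx.exists_dual hb).imp fun F hF _ => hF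
    · exact ⟨0, fun h => absurd h hx⟩
  choose F hF using hex
  have h1 : ∀ᵐ x ∂μ, ∀ n, x ∈ {x | BoundedEval hb x} → (p n).1 x = F x (p n) :=
    ae_all_iff.2 fun n => ae_eq_dual_of_mem_sobolevGraph hb hF (hp n)
  have h2 := ae_eq_dual_of_mem_sobolevGraph hb (s := {x | BoundedEval hb x}) hF hq
  filter_upwards [h1, h2, ae_boundedEval hb e] with x h1 h2 h3 hx
  rw [h2 (h3 hx)]
  exact (h (F x)).congr fun n => (h1 n (h3 hx)).symm

end

section

variable (β : Measure ℝ) [IsFiniteMeasure β]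

theorem monotone_measureReal_Iic : Monotone fun x => β.real (Set.Iic x) :=
  fun _ _ h => measureReal_mono (Set.Iic_subset_Iic.2 h)

theorem tendsto_measureReal_Iic_atTop :
    Tendsto (fun x => β.real (Set.Iic x)) atTop (𝓝 (β.real Set.univ)) :=
  (ENNReal.continuousAt_toReal (measure_ne_top β _)).tendsto.comp (tendsto_measure_Iic_atTop β)

theorem tendsto_measureReal_Iic_atBot :
    Tendsto (fun x => β.real (Set.Iic x)) atBot (𝓝 0) := by
  have h := tendsto_measure_iInter_atBot (μ := β) (s := fun x : ℝ => Set.Iic x)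
    (fun _ => measurableSet_Iic.nullMeasurableSet) (fun _ _ h => Set.Iic_subset_Iic.2 h)
    ⟨0, measure_ne_top _ _⟩
  have h0 : ⋂ x : ℝ, Set.Iic x = ∅ := by
    refine Set.eq_empty_of_forall_notMem fun y hy => ?_
    have := Set.mem_iInter.1 hy (y - 1)
    rw [Set.mem_Iic] at this
    linarith
  rw [h0, measure_empty] at h
  exact (ENNReal.continuousAt_toReal ENNReal.zero_ne_top).tendsto.comp h

theorem tendsto_measureReal_Iic_nhdsGT (a : ℝ) :
    Tendsto (fun x => β.real (Set.Iic x)) (𝓝[>] a) (𝓝 (β.real (Set.Iic a))) := by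
  have h := tendsto_measure_biInter_gt (μ := β) (s := fun x : ℝ => Set.Iic x) (a := a)
    (fun _ _ => measurableSet_Iic.nullMeasurableSet) (fun _ _ _ h => Set.Iic_subset_Iic.2 h)
    ⟨a + 1, by simp, measure_ne_top _ _⟩
  have h0 : ⋂ x : ℝ, ⋂ (_ : x > a), Set.Iic x = Set.Iic a := by
    ext y
    simp only [Set.mem_iInter, Set.mem_Iic]
    exact ⟨fun h => le_of_forall_gt_imp_ge_of_dense h, fun h x hx => h.trans hx.le⟩
  rw [h0] at h
  exact (ENNReal.continuousAt_toReal (measure_ne_top β _)).tendsto.comp h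

theorem continuous_measureReal_Iic [NullSingletonClass β] :
    Continuous fun x => β.real (Set.Iic x) := by
  have h1 : ∀ x, β.real (Set.Iic x) = (∫ _ in (0 : ℝ)..x, (1 : ℝ) ∂β) + β.real (Set.Iic 0) := by
    intro x
    rw [← intervalIntegral.integral_Iic_sub_Iic (integrable_const _).integrableOn
      (integrable_const _).integrableOn]
    simp
  have h2 : Continuous fun x => ∫ _ in (0 : ℝ)..x, (1 : ℝ) ∂β :=
    intervalIntegral.continuous_primitive
      (fun _ _ => (integrable_const _).intervalIntegrable) 0
  exact (h2.add continuous_const).congr fun x => (h1 x).symm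

/-- The distribution function of an atomless measure transports the measure to a uniform one. -/
theorem measureReal_measureReal_Iic_le [NullSingletonClass β] {h : ℝ} (h0 : 0 ≤ h)
    (h1 : h < β.real Set.univ) : β.real {x | β.real (Set.Iic x) ≤ h} = h := by
  set F : ℝ → ℝ := fun x => β.real (Set.Iic x) with hF
  have hmono : Monotone F := monotone_measureReal_Iic β
  have hcont : Continuous F := continuous_measureReal_Iic β
  change β.real {x | F x ≤ h} = h
  rcases Set.eq_empty_or_nonempty {x | F x ≤ h} with he | hne
  · rw [he, measureReal_empty]
    refine le_antisymm h0 (ge_of_tendsto' (tendsto_measureReal_Iic_atBot β) fun x => ?_)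
    by_contra hx
    exact (Set.eq_empty_iff_forall_notMem.1 he x) (not_le.1 hx).le
  · have hbdd : BddAbove {x | F x ≤ h} := by
      obtain ⟨y, hy⟩ := ((tendsto_measureReal_Iic_atTop β).eventually_const_lt h1).exists
      refine ⟨y, fun x hx => ?_⟩
      by_contra hxy
      exact absurd (hmono (not_le.1 hxy).le) (not_le.2 (lt_of_le_of_lt hx hy))
    have hclosed : IsClosed {x | F x ≤ h} := isClosed_le hcont continuous_const
    have hmem : F (sSup {x | F x ≤ h}) ≤ h := hclosed.csSup_mem hne hbdd
    have heq : {x | F x ≤ h} = Set.Iic (sSup {x | F x ≤ h}) :=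
      Set.Subset.antisymm (fun x hx => le_csSup hbdd hx) fun x hx => (hmono hx).trans hmem
    rw [heq]
    refine le_antisymm hmem ?_
    refine ge_of_tendsto (tendsto_measureReal_Iic_nhdsGT β _) ?_
    filter_upwards [self_mem_nhdsWithin] with x hx
    by_contra hlt
    exact absurd (le_csSup hbdd (not_le.1 hlt).le) (not_le.2 hx)

theorem measure_measureReal_Iic_nonpos [NullSingletonClass β] :
    β {x | β.real (Set.Iic x) ≤ 0} = 0 := by
  rcases (measureReal_nonneg (μ := β) (s := Set.univ)).eq_or_lt with h | h
  · rw [eq_comm, measureReal_eq_zero_iff] at h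
    exact measure_mono_null (Set.subset_univ _) h
  · exact (measureReal_eq_zero_iff).1 (measureReal_measureReal_Iic_le β le_rfl h)

theorem measure_le_measureReal_Iic [NullSingletonClass β] :
    β {x | β.real Set.univ ≤ β.real (Set.Iic x)} = 0 := by
  have hmeas : MeasurableSet {x | β.real Set.univ ≤ β.real (Set.Iic x)} :=
    measurableSet_le measurable_const (continuous_measureReal_Iic β).measurable
  rw [← measureReal_eq_zero_iff]
  refine le_antisymm (le_of_forall_pos_le_add fun ε hε => ?_) measureReal_nonneg
  rw [zero_add]
  have h2 := measureReal_add_measureReal_compl (μ := β) hmeas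
  by_cases hε' : ε ≤ β.real Set.univ
  · have h1 := measureReal_measureReal_Iic_le β (h := β.real Set.univ - ε) (by linarith)
      (by linarith)
    have h3 : β.real {x | β.real (Set.Iic x) ≤ β.real Set.univ - ε} ≤
        β.real {x | β.real Set.univ ≤ β.real (Set.Iic x)}ᶜ := by
      refine measureReal_mono fun x hx hx' => ?_
      have hx1 : β.real (Set.Iic x) ≤ β.real Set.univ - ε := hx
      have hx2 : β.real Set.univ ≤ β.real (Set.Iic x) := hx'
      linarith
    linarith
  · have h4 := measureReal_nonneg (μ := β) (s := {x | β.real Set.univ ≤ β.real (Set.Iic x)}ᶜ)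
    linarith

/-- The monotone rearrangement: an atomless measure on the line can be transported to any measure
of the same mass by a map that is nondecreasing almost everywhere. -/
theorem exists_monotone_transport [NullSingletonClass β] (ν : Measure ℝ) [IsFiniteMeasure ν]
    (hmass : β Set.univ = ν Set.univ) :
    ∃ S : ℝ → ℝ, Measurable S ∧ β.map S = ν ∧ ∀ s, β (Set.Iic s) = 0 ∨ β (Set.Iic s)ᶜ = 0 ∨
      ∃ c, (∀ᵐ x ∂β, x ∈ Set.Iic s → S x ≤ c) ∧ ∀ᵐ x ∂β, x ∉ Set.Iic s → c ≤ S x := by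
  set F : ℝ → ℝ := fun x => β.real (Set.Iic x) with hF
  set H : ℝ → ℝ := fun x => ν.real (Set.Iic x) with hH
  have hFmono : Monotone F := monotone_measureReal_Iic β
  have hHmono : Monotone H := monotone_measureReal_Iic ν
  have hFmeas : Measurable F := hFmono.measurable
  have hmass' : β.real Set.univ = ν.real Set.univ := by
    rw [Measure.real, Measure.real, hmass]
  let g : Set ℝ := {x | 0 < F x ∧ F x < β.real Set.univ}
  have hg : MeasurableSet g :=
    (measurableSet_lt measurable_const hFmeas).inter (measurableSet_lt hFmeas measurable_const)
  have hgae : ∀ᵐ x ∂β, x ∈ g := by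
    filter_upwards [measure_eq_zero_iff_ae_notMem.1 (measure_measureReal_Iic_nonpos β),
      measure_eq_zero_iff_ae_notMem.1 (measure_le_measureReal_Iic β)] with x h1 h2
    exact ⟨not_le.1 h1, not_le.1 h2⟩
  classical
  let S : ℝ → ℝ := fun x => if x ∈ g then sInf {t | F x ≤ H t} else 0
  have hSg : ∀ x ∈ g, ∀ t, S x ≤ t ↔ F x ≤ H t := by
    intro x hx t
    have hS : S x = sInf {t | F x ≤ H t} := if_pos hx
    have hne : {t | F x ≤ H t}.Nonempty := by
      have h1 : F x < ν.real Set.univ := hmass' ▸ hx.2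
      obtain ⟨y, hy⟩ := ((tendsto_measureReal_Iic_atTop ν).eventually_const_lt h1).exists
      exact ⟨y, hy.le⟩
    have hbdd : BddBelow {t | F x ≤ H t} := by
      obtain ⟨y, hy⟩ := ((tendsto_measureReal_Iic_atBot ν).eventually_lt_const hx.1).exists
      refine ⟨y, fun z hz => ?_⟩
      by_contra hzy
      exact absurd (hHmono (not_le.1 hzy).le) (not_le.2 (lt_of_lt_of_le hy hz))
    have hmem : F x ≤ H (sInf {t | F x ≤ H t}) := by
      refine ge_of_tendsto (tendsto_measureReal_Iic_nhdsGT ν _) ?_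
      filter_upwards [self_mem_nhdsWithin] with y hy
      obtain ⟨z, hz, hzy⟩ := exists_lt_of_csInf_lt hne hy
      exact le_trans hz (hHmono hzy.le)
    rw [hS]
    exact ⟨fun h => hmem.trans (hHmono h), fun h => csInf_le hbdd h⟩
  have hSmeas : Measurable S := by
    refine measurable_of_Iic fun t => ?_
    have h1 : S ⁻¹' Set.Iic t = (g ∩ {x | F x ≤ H t}) ∪ (gᶜ ∩ {_x | (0 : ℝ) ≤ t}) := by
      ext x
      by_cases hx : x ∈ g
      · simpa [hx] using hSg x hx t
      · simp [hx, S]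
    rw [h1]
    exact (hg.inter (measurableSet_le hFmeas measurable_const)).union
      (hg.compl.inter (MeasurableSet.const _))
  refine ⟨S, hSmeas, ?_, fun s => ?_⟩
  · refine Measure.ext_of_Iic _ _ fun t => ?_
    rw [Measure.map_apply hSmeas measurableSet_Iic]
    have h1 : β (S ⁻¹' Set.Iic t) = β {x | F x ≤ H t} := by
      refine measure_congr ?_
      filter_upwards [hgae] with x hx
      exact propext (hSg x hx t)
    rw [h1, ← measureReal_eq_measureReal_iff (measure_ne_top _ _) (measure_ne_top _ _)]
    rcases lt_or_ge (H t) (β.real Set.univ) with hlt | hge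
    · exact measureReal_measureReal_Iic_le β measureReal_nonneg hlt
    · have h2 : {x | F x ≤ H t} = Set.univ :=
        Set.eq_univ_of_forall fun x => le_trans (measureReal_mono (Set.subset_univ _)) hge
      rw [h2]
      exact le_antisymm hge (hmass' ▸ measureReal_mono (Set.subset_univ _))
  · by_cases hs : s ∈ g
    · right; right
      refine ⟨S s, ?_, ?_⟩
      · filter_upwards [hgae] with x hx hxs
        rw [hSg x hx]
        exact (hFmono hxs).trans ((hSg s hs _).1 le_rfl)
      · filter_upwards [hgae] with x hx hxs
        rw [hSg s hs]
        exact (hFmono (not_le.1 hxs).le).trans ((hSg x hx _).1 le_rfl)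
    · have hs' : ¬ (0 < F s ∧ F s < β.real Set.univ) := hs
      rw [not_and_or, not_lt, not_lt] at hs'
      rcases hs' with h | h
      · left
        exact (measureReal_eq_zero_iff).1 (le_antisymm h measureReal_nonneg)
      · right; left
        have h2 := measureReal_add_measureReal_compl (μ := β) (s := Set.Iic s) measurableSet_Iic
        refine (measureReal_eq_zero_iff).1 (le_antisymm ?_ measureReal_nonneg)
        have h3 : β.real Set.univ ≤ β.real (Set.Iic s) := h
        linarith

variable {β}

theorem integral_id_mul_nonpos {R : ℝ} (hb : ∀ᵐ x ∂β, |x| ≤ R) {D : ℝ → ℝ} (hD : Integrable D β)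
    (h0 : ∫ x, D x ∂β = 0) (hIic : ∀ s, 0 ≤ ∫ x in Set.Iic s, D x ∂β) :
    ∫ x, x * D x ∂β ≤ 0 := by
  let f : ℝ → ℝ → ℝ := fun x s => (Set.Iic s).indicator D x
  have hf : Integrable (Function.uncurry f) (β.prod (volume.restrict (Set.Ioc (-R) R))) := by
    have h1 : Integrable (fun p : ℝ × ℝ => D p.1)
        (β.prod (volume.restrict (Set.Ioc (-R) R))) := hD.comp_fst _
    exact h1.indicator (measurableSet_le measurable_fst measurable_snd)
  have hswap := integral_integral_swap hf
  have hleft : ∀ᵐ x ∂β, ∫ s in Set.Ioc (-R) R, f x s = (R - x) * D x := by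
    filter_upwards [hb] with x hx
    rw [abs_le] at hx
    have h1 : ∀ s, f x s = (Set.Ici x).indicator (fun _ => D x) s := fun s => rfl
    simp_rw [h1]
    rw [integral_indicator measurableSet_Ici, setIntegral_const, measureReal_restrict_apply
      measurableSet_Ici, smul_eq_mul]
    congr 1
    have h2 : (Set.Ici x ∩ Set.Ioc (-R) R : Set ℝ) =ᵐ[volume] Set.Ioc x R := by
      filter_upwards [compl_mem_ae_iff.2 (measure_singleton (μ := (volume : Measure ℝ)) x)]
        with s hs
      have hs' : s ≠ x := hs
      refine propext ⟨fun h => ⟨lt_of_le_of_ne h.1 hs'.symm, h.2.2⟩,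
        fun h => ⟨h.1.le, lt_of_le_of_lt hx.1 h.1, h.2⟩⟩
    rw [measureReal_congr h2, Real.volume_real_Ioc_of_le hx.2]
  rw [integral_congr_ae hleft] at hswap
  have hright : 0 ≤ ∫ s in Set.Ioc (-R) R, ∫ x, f x s ∂β := by
    refine integral_nonneg fun s => ?_
    change 0 ≤ ∫ x, (Set.Iic s).indicator D x ∂β
    rw [integral_indicator measurableSet_Iic]
    exact hIic s
  have hmul : Integrable (fun x => x * D x) β :=
    hD.bdd_mul measurable_id.aestronglyMeasurable hb
  have h3 : ∫ x, (R - x) * D x ∂β = -∫ x, x * D x ∂β := by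
    simp_rw [sub_mul]
    rw [integral_sub (hD.const_mul R) hmul, integral_const_mul, h0, mul_zero, zero_sub]
  rw [h3] at hswap
  linarith

/-- The monotone rearrangement maximizes the correlation with the identity, among the functions
that it dominates in the convex order. -/
theorem integral_id_mul_le_of_monotone {R : ℝ} (hb : ∀ᵐ x ∂β, |x| ≤ R) {S T : ℝ → ℝ}
    (hS : Integrable S β) (hT : Integrable T β) (hST : ∫ x, T x ∂β = ∫ x, S x ∂β)
    (hmono : ∀ s, β (Set.Iic s) = 0 ∨ β (Set.Iic s)ᶜ = 0 ∨
      ∃ c, (∀ᵐ x ∂β, x ∈ Set.Iic s → S x ≤ c) ∧ ∀ᵐ x ∂β, x ∉ Set.Iic s → c ≤ S x)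
    (hconv : ∀ s c, ∫ x in Set.Iic s, (c - T x) ∂β ≤ ∫ x, max (c - S x) 0 ∂β) :
    ∫ x, x * T x ∂β ≤ ∫ x, x * S x ∂β := by
  have hsub : ∫ x, x * (T x - S x) ∂β ≤ 0 := by
    refine integral_id_mul_nonpos hb (hT.sub hS) ?_ fun s => ?_
    · rw [integral_sub hT hS, hST, sub_self]
    rw [integral_sub hT.integrableOn hS.integrableOn, sub_nonneg]
    rcases hmono s with h | h | ⟨c, h1, h2⟩
    · rw [setIntegral_measure_zero _ h, setIntegral_measure_zero _ h]
    · have h1 : Set.Iic s =ᵐ[β] Set.univ := ae_eq_univ.2 h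
      rw [setIntegral_congr_set h1, setIntegral_congr_set h1, setIntegral_univ, setIntegral_univ,
        hST]
    · have h3 : ∫ x, max (c - S x) 0 ∂β = ∫ x in Set.Iic s, (c - S x) ∂β := by
        rw [← integral_indicator measurableSet_Iic]
        refine integral_congr_ae ?_
        filter_upwards [h1, h2] with x h1 h2
        by_cases hx : x ∈ Set.Iic s
        · rw [Set.indicator_of_mem hx, max_eq_left (sub_nonneg.2 (h1 hx))]
        · rw [Set.indicator_of_notMem hx, max_eq_right (sub_nonpos.2 (h2 hx))]
      have h4 := hconv s c
      rw [h3, integral_sub (integrable_const _) hT.integrableOn,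
        integral_sub (integrable_const _) hS.integrableOn] at h4
      linarith
  have hmul : ∀ {D : ℝ → ℝ}, Integrable D β → Integrable (fun x => x * D x) β := fun hD =>
    hD.bdd_mul measurable_id.aestronglyMeasurable hb
  simp_rw [mul_sub] at hsub
  rw [integral_sub (hmul hT) (hmul hS)] at hsub
  linarith

end

/-- Fatou's lemma for the Bochner integral. -/
theorem integral_le_of_ae_tendsto {Ω : Type*} [MeasurableSpace Ω] {α : Measure Ω}
    {f : ℕ → Ω → ℝ} {g : Ω → ℝ} {a : ℕ → ℝ} {l : ℝ} (hf : ∀ n, Integrable (f n) α)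
    (hf0 : ∀ n x, 0 ≤ f n x) (hg : Integrable g α) (hg0 : ∀ x, 0 ≤ g x)
    (hlim : ∀ᵐ x ∂α, Tendsto (fun n => f n x) atTop (𝓝 (g x)))
    (hle : ∀ n, ∫ x, f n x ∂α ≤ a n) (ha : Tendsto a atTop (𝓝 l)) : ∫ x, g x ∂α ≤ l := by
  have hl : 0 ≤ l := ge_of_tendsto' ha fun n => (integral_nonneg (hf0 n)).trans (hle n)
  rw [← ENNReal.ofReal_le_ofReal_iff hl,
    ofReal_integral_eq_lintegral_ofReal hg (Eventually.of_forall hg0)]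
  calc ∫⁻ x, ENNReal.ofReal (g x) ∂α
      = ∫⁻ x, liminf (fun n => ENNReal.ofReal (f n x)) atTop ∂α := by
        refine lintegral_congr_ae ?_
        filter_upwards [hlim] with x hx
        exact ((ENNReal.continuous_ofReal.tendsto _).comp hx).liminf_eq.symm
    _ ≤ liminf (fun n => ∫⁻ x, ENNReal.ofReal (f n x) ∂α) atTop :=
        lintegral_liminf_le' fun n => (hf n).aestronglyMeasurable.aemeasurable.ennreal_ofReal
    _ ≤ liminf (fun n => ENNReal.ofReal (a n)) atTop := by
        refine liminf_le_liminf (Eventually.of_forall fun n => ?_)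
        rw [← ofReal_integral_eq_lintegral_ofReal (hf n) (Eventually.of_forall (hf0 n))]
        exact ENNReal.ofReal_le_ofReal (hle n)
    _ = ENNReal.ofReal l := ((ENNReal.continuous_ofReal.tendsto _).comp ha).liminf_eq

/-- If the images of `α` by `f n` are all smaller than `ν`, then so is its image by a pointwise
limit of `f`. -/
theorem map_le_of_ae_tendsto {Ω : Type*} [MeasurableSpace Ω] {α : Measure Ω} {ν : Measure ℝ}
    [IsFiniteMeasure ν] {f : ℕ → Ω → ℝ} {g : Ω → ℝ} (hf : ∀ n, Measurable (f n))
    (hg : Measurable g) (hlim : ∀ᵐ x ∂α, Tendsto (fun n => f n x) atTop (𝓝 (g x)))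
    (hle : ∀ n, α.map (f n) ≤ ν) : α.map g ≤ ν := by
  have hopen : ∀ U : Set ℝ, IsOpen U → α.map g U ≤ ν U := by
    intro U hU
    rw [Measure.map_apply hg hU.measurableSet,
      ← lintegral_indicator_one (hg hU.measurableSet)]
    calc ∫⁻ x, (g ⁻¹' U).indicator 1 x ∂α
        ≤ ∫⁻ x, liminf (fun n => ((f n) ⁻¹' U).indicator (1 : Ω → ℝ≥0∞) x) atTop ∂α := by
          refine lintegral_mono_ae ?_
          filter_upwards [hlim] with x hx
          by_cases hxU : x ∈ g ⁻¹' U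
          · rw [Set.indicator_of_mem hxU]
            refine le_liminf_of_le (by isBoundedDefault) ?_
            filter_upwards [hx (hU.mem_nhds hxU)] with n hn
            rw [Set.indicator_of_mem (show x ∈ f n ⁻¹' U from hn)]
          · rw [Set.indicator_of_notMem hxU]
            exact zero_le
      _ ≤ liminf (fun n => ∫⁻ x, ((f n) ⁻¹' U).indicator (1 : Ω → ℝ≥0∞) x ∂α) atTop :=
          lintegral_liminf_le fun n => measurable_one.indicator (hf n hU.measurableSet)
      _ ≤ liminf (fun _ : ℕ => ν U) atTop := by
          refine liminf_le_liminf (Eventually.of_forall fun n => ?_)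
          rw [lintegral_indicator_one (hf n hU.measurableSet),
            ← Measure.map_apply (hf n) hU.measurableSet]
          exact hle n U
      _ = ν U := liminf_const _
  refine Measure.le_iff.2 fun s _ => ?_
  refine ENNReal.le_of_forall_pos_le_add fun ε hε _ => ?_
  obtain ⟨U, hsU, hU, hlt⟩ := s.exists_isOpen_lt_add (μ := ν) (measure_ne_top _ _)
    (ENNReal.coe_pos.2 hε).ne'
  exact ((measure_mono hsU).trans (hopen U hU)).trans hlt.le

theorem tendsto_setIntegral_of_tendsto_inner {μ : Measure ℝ} [IsFiniteMeasure μ]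
    {f : ℕ → Lp ℝ 2 μ} {g : Lp ℝ 2 μ}
    (h : ∀ w, Tendsto (fun n => inner ℝ (f n) w) atTop (𝓝 (inner ℝ g w))) {s : Set ℝ}
    (hs : MeasurableSet s) :
    Tendsto (fun n => ∫ x in s, f n x ∂μ) atTop (𝓝 (∫ x in s, g x ∂μ)) := by
  have h1 := h (indicatorConstLp 2 hs (measure_ne_top μ s) (1 : ℝ))
  simpa only [fun u : Lp ℝ 2 μ => real_inner_comm
    (indicatorConstLp 2 hs (measure_ne_top μ s) (1 : ℝ)) u,
    L2.inner_indicatorConstLp_one] using h1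

/-- A weak limit of transport maps that is a pointwise limit outside of an atomless part of `μ` can
be modified there, by monotone rearrangement, to a transport map with at least the same correlation
with the identity. -/
theorem exists_transport_of_tendsto_inner {μ : Measure ℝ} [IsFiniteMeasure μ] {R : ℝ}
    (hb : ∀ᵐ x ∂μ, |x| ≤ R) {B : Set ℝ} (hB : MeasurableSet B) (hatom : ∀ x ∈ B, μ {x} = 0)
    {ν : Measure ℝ} {f : ℕ → Lp ℝ 2 μ} {T : Lp ℝ 2 μ} (hmap : ∀ n, μ.map (f n) = ν)
    (hweak : ∀ w, Tendsto (fun n => inner ℝ (f n) w) atTop (𝓝 (inner ℝ T w)))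
    (hae : ∀ᵐ x ∂μ, x ∉ B → Tendsto (fun n => f n x) atTop (𝓝 (T x))) :
    ∃ U : Lp ℝ 2 μ, μ.map U = ν ∧ (∀ᵐ x ∂μ, x ∉ B → U x = T x) ∧
      ∫ x, x * T x ∂μ ≤ ∫ x, x * U x ∂μ := by
  have hfin : IsFiniteMeasure ν := hmap 0 ▸ inferInstance
  have hfm : ∀ n, Measurable (f n) := fun n => (Lp.stronglyMeasurable (f n)).measurable
  have hTm : Measurable T := (Lp.stronglyMeasurable T).measurable
  have hsplit : μ.restrict B + μ.restrict Bᶜ = μ := Measure.restrict_add_restrict_compl hB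
  have hαae : ∀ᵐ x ∂μ.restrict Bᶜ, Tendsto (fun n => f n x) atTop (𝓝 (T x)) := by
    rw [ae_restrict_iff' hB.compl]
    exact hae
  have hle : (μ.restrict Bᶜ).map T ≤ ν :=
    map_le_of_ae_tendsto hfm hTm hαae fun n => by
      rw [← hmap n]
      exact Measure.map_mono Measure.restrict_le_self (hfm n)
  set ν' := ν - (μ.restrict Bᶜ).map T with hν'
  have hadd : ν' + (μ.restrict Bᶜ).map T = ν := Measure.sub_add_cancel_of_le hle
  have hν'le : ν' ≤ ν := Measure.sub_le
  have hfin' : IsFiniteMeasure ν' := isFiniteMeasure_of_le ν hν'le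
  have hna : NullSingletonClass (μ.restrict B) := by
    refine ⟨fun x => ?_⟩
    rw [Measure.restrict_apply (measurableSet_singleton x)]
    by_cases hx : x ∈ B
    · exact measure_mono_null Set.inter_subset_left (hatom x hx)
    · rw [Set.singleton_inter_eq_empty.2 hx, measure_empty]
  have hmass : μ.restrict B Set.univ = ν' Set.univ := by
    have h1 : μ.restrict B Set.univ + μ.restrict Bᶜ Set.univ =
        ν' Set.univ + μ.restrict Bᶜ Set.univ := by
      have h2 : (μ.restrict Bᶜ).map T Set.univ = μ.restrict Bᶜ Set.univ := by
        rw [Measure.map_apply hTm MeasurableSet.univ, Set.preimage_univ]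
      rw [← Measure.add_apply, hsplit, ← h2, ← Measure.add_apply, hadd, ← hmap 0,
        Measure.map_apply (hfm 0) MeasurableSet.univ, Set.preimage_univ]
    exact (ENNReal.add_left_inj (measure_ne_top _ _)).1 h1
  obtain ⟨S, hSm, hSmap, hSmono⟩ := exists_monotone_transport (μ.restrict B) ν' hmass
  have hid : MemLp id 2 ν := by
    rw [← hmap 0, memLp_map_measure_iff aestronglyMeasurable_id (hfm 0).aemeasurable]
    exact Lp.memLp (f 0)
  have hSL : MemLp S 2 (μ.restrict B) := by
    have h1 : MemLp id 2 ((μ.restrict B).map S) := by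
      rw [hSmap]
      exact hid.mono_measure hν'le
    exact h1.comp_of_map hSm.aemeasurable
  classical
  have hUL : MemLp (B.piecewise S T) 2 μ := MemLp.piecewise hB hSL ((Lp.memLp T).restrict _)
  have hUB : ∀ᵐ x ∂μ.restrict B, hUL.toLp _ x = S x := by
    rw [ae_restrict_iff' hB]
    filter_upwards [hUL.coeFn_toLp] with x hx hxB
    rw [hx, Set.piecewise_eq_of_mem _ _ _ hxB]
  have hUBc : ∀ᵐ x ∂μ, x ∉ B → hUL.toLp _ x = T x := by
    filter_upwards [hUL.coeFn_toLp] with x hx hxB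
    rw [hx, Set.piecewise_eq_of_notMem _ _ _ hxB]
  have hUBc' : ∀ᵐ x ∂μ.restrict Bᶜ, hUL.toLp _ x = T x := (ae_restrict_iff' hB.compl).2 hUBc
  have hTi : Integrable T μ := integrable_of_Lp_two T
  have hSi : Integrable S (μ.restrict B) := hSL.integrable (by norm_num)
  have hbB : ∀ᵐ x ∂μ.restrict B, |x| ≤ R := ae_restrict_of_ae hb
  have hνsplit : ∀ {k : ℝ → ℝ}, Continuous k → Integrable k ν →
      ∫ y, k y ∂ν = ∫ x in B, k (S x) ∂μ + ∫ x in Bᶜ, k (T x) ∂μ := by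
    intro k hk hki
    have hki' : Integrable k (ν' + (μ.restrict Bᶜ).map T) := hadd.symm ▸ hki
    rw [integrable_add_measure] at hki'
    calc ∫ y, k y ∂ν = ∫ y, k y ∂(ν' + (μ.restrict Bᶜ).map T) := by rw [hadd]
      _ = ∫ y, k y ∂ν' + ∫ y, k y ∂(μ.restrict Bᶜ).map T :=
        integral_add_measure hki'.1 hki'.2
      _ = _ := by
        rw [integral_map hTm.aemeasurable hk.aestronglyMeasurable, ← hSmap,
          integral_map hSm.aemeasurable hk.aestronglyMeasurable]
  have hνf : ∀ {k : ℝ → ℝ}, Continuous k → ∀ n, ∫ y, k y ∂ν = ∫ x, k (f n x) ∂μ := by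
    intro k hk n
    rw [← hmap n, integral_map (hfm n).aemeasurable hk.aestronglyMeasurable]
  have hidi : Integrable (fun y : ℝ => y) ν := hid.integrable (by norm_num)
  have hST : ∫ x in B, T x ∂μ = ∫ x in B, S x ∂μ := by
    have h1 := tendsto_setIntegral_of_tendsto_inner hweak MeasurableSet.univ
    simp only [setIntegral_univ, ← hνf continuous_id'] at h1
    have h2 : ∫ y, y ∂ν = ∫ x, T x ∂μ := tendsto_nhds_unique tendsto_const_nhds h1
    rw [hνsplit continuous_id' hidi, ← integral_add_compl hB hTi] at h2
    linarith
  have hconv : ∀ s c, ∫ x in Set.Iic s, (c - T x) ∂(μ.restrict B) ≤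
      ∫ x, max (c - S x) 0 ∂(μ.restrict B) := by
    intro s c
    have hk : Continuous fun y : ℝ => max (c - y) 0 := by fun_prop
    have hpos : ∀ {m : Measure ℝ} [IsFiniteMeasure m] {h : ℝ → ℝ}, Integrable h m →
        Integrable (fun x => max (c - h x) 0) m := fun hh =>
      ((integrable_const c).sub hh).pos_part
    have hEm : MeasurableSet (Set.Iic s ∩ B) := measurableSet_Iic.inter hB
    have hfi : ∀ n, Integrable (f n) μ := fun n => integrable_of_Lp_two (f n)
    have hd : Tendsto (fun n => ∫ y, max (c - y) 0 ∂ν - ∫ x in Set.Iic s ∩ B, (c - f n x) ∂μ)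
        atTop (𝓝 (∫ y, max (c - y) 0 ∂ν - ∫ x in Set.Iic s ∩ B, (c - T x) ∂μ)) := by
      simp_rw [integral_sub (integrable_const c).integrableOn (hfi _).integrableOn]
      rw [integral_sub (integrable_const c).integrableOn hTi.integrableOn]
      exact ((tendsto_setIntegral_of_tendsto_inner hweak hEm).const_sub _).const_sub _
    have hbound := integral_le_of_ae_tendsto (α := μ.restrict Bᶜ)
      (f := fun n x => max (c - f n x) 0) (g := fun x => max (c - T x) 0)
      (fun n => hpos (hfi n).restrict) (fun _ _ => le_max_right _ _) (hpos hTi.restrict)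
      (fun _ => le_max_right _ _)
      (hαae.mono fun x hx => ((hk.tendsto _).comp hx)) (fun n => ?_) hd
    · rw [hνsplit hk (hpos hidi)] at hbound
      rw [Measure.restrict_restrict measurableSet_Iic]
      linarith
    · rw [hνf hk n, ← integral_add_compl hB (hpos (hfi n))]
      have h1 : ∫ x in Set.Iic s ∩ B, (c - f n x) ∂μ ≤
          ∫ x in Set.Iic s ∩ B, max (c - f n x) 0 ∂μ :=
        setIntegral_mono ((integrable_const c).sub (hfi n)).integrableOn
          (hpos (hfi n)).integrableOn fun x => le_max_left _ _
      have h2 : ∫ x in Set.Iic s ∩ B, max (c - f n x) 0 ∂μ ≤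
          ∫ x in B, max (c - f n x) 0 ∂μ :=
        setIntegral_mono_set (hpos (hfi n)).integrableOn
          (Eventually.of_forall fun _ => le_max_right _ _)
          (Eventually.of_forall fun x (hx : x ∈ Set.Iic s ∩ B) => hx.2)
      linarith
  refine ⟨hUL.toLp _, ?_, hUBc, ?_⟩
  · have hUm : Measurable (hUL.toLp (B.piecewise S T)) := (Lp.stronglyMeasurable _).measurable
    rw [← hadd, ← hSmap]
    calc μ.map (hUL.toLp (B.piecewise S T))
        = (μ.restrict B + μ.restrict Bᶜ).map (hUL.toLp (B.piecewise S T)) := by rw [hsplit]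
      _ = (μ.restrict B).map (hUL.toLp (B.piecewise S T)) +
          (μ.restrict Bᶜ).map (hUL.toLp (B.piecewise S T)) := Measure.map_add _ _ hUm
      _ = _ := by rw [Measure.map_congr hUB, Measure.map_congr hUBc']
  · have hmul : ∀ g : Lp ℝ 2 μ, Integrable (fun x => x * g x) μ := fun g =>
      (integrable_of_Lp_two g).bdd_mul measurable_id.aestronglyMeasurable hb
    rw [← integral_add_compl hB (hmul T), ← integral_add_compl hB (hmul _)]
    have h1 : ∫ x in B, x * hUL.toLp (B.piecewise S T) x ∂μ = ∫ x in B, x * S x ∂μ :=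
      integral_congr_ae (hUB.mono fun x hx => by simp only [hx])
    have h2 : ∫ x in Bᶜ, x * hUL.toLp (B.piecewise S T) x ∂μ = ∫ x in Bᶜ, x * T x ∂μ :=
      integral_congr_ae (hUBc'.mono fun x hx => by simp only [hx])
    rw [h1, h2]
    exact add_le_add_left
      (integral_id_mul_le_of_monotone hbB hSi hTi.restrict hST hSmono hconv) _

/-- The class of the identity. -/
noncomputable def idLp {μ : Measure ℝ} [IsFiniteMeasure μ] {R : ℝ} (hb : ∀ᵐ x ∂μ, |x| ≤ R) :
    Lp ℝ 2 μ := (memLp_two_of_continuous hb continuous_id).toLp id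

section

variable {μ : Measure ℝ} [IsFiniteMeasure μ] {R : ℝ} (hb : ∀ᵐ x ∂μ, |x| ≤ R)

theorem idLp_ae : ∀ᵐ x ∂μ, idLp hb x = x :=
  (memLp_two_of_continuous hb continuous_id).coeFn_toLp

theorem inner_idLp (T : Lp ℝ 2 μ) : inner ℝ T (idLp hb) = ∫ x, x * T x ∂μ := by
  rw [L2.inner_def]
  refine integral_congr_ae ?_
  filter_upwards [idLp_ae hb] with x hx
  simp [hx]

theorem norm_sq_eq_integral {μ : Measure ℝ} (u : Lp ℝ 2 μ) : ‖u‖ ^ 2 = ∫ x, u x ^ 2 ∂μ := by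
  rw [← real_inner_self_eq_norm_sq, L2.inner_def]
  refine integral_congr_ae (Eventually.of_forall fun x => ?_)
  simp [sq]

theorem transportEnergy_eq (T : Lp ℝ 2 μ) :
    transportEnergy μ T =
      ENNReal.ofReal (‖T - idLp hb‖ ^ 2 + ‖tangentialGradient μ T‖ ^ 2) := by
  have h1 := (Lp.memLp (T - idLp hb)).integrable_sq
  have h2 := (Lp.memLp (tangentialGradient μ T)).integrable_sq
  have h3 : Integrable (fun x => (T - idLp hb) x ^ 2 + tangentialGradient μ T x ^ 2) μ :=
    h1.add h2
  rw [transportEnergy, norm_sq_eq_integral, norm_sq_eq_integral, ← integral_add h1 h2,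
    ofReal_integral_eq_lintegral_ofReal h3 (Eventually.of_forall fun x => by positivity)]
  refine lintegral_congr_ae ?_
  filter_upwards [Lp.coeFn_sub T (idLp hb), idLp_ae hb] with x h1 h2
  rw [h1, Pi.sub_apply, h2, sq_abs, sq_abs]

theorem norm_eq_of_map_eq {μ : Measure ℝ} {S T : Lp ℝ 2 μ} (h : μ.map S = μ.map T) :
    ‖S‖ = ‖T‖ := by
  have h1 : ∀ U : Lp ℝ 2 μ, ‖U‖ ^ 2 = ∫ y, y ^ 2 ∂μ.map U := fun U => by
    rw [norm_sq_eq_integral, integral_map (Lp.stronglyMeasurable U).measurable.aemeasurable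
      (by fun_prop)]
  rw [← sq_eq_sq₀ (norm_nonneg _) (norm_nonneg _), h1, h1, h]

theorem exists_seq_rat_atoms (μ : Measure ℝ) [IsFiniteMeasure μ] :
    ∃ e : ℕ → ℝ, (∀ q : ℚ, ∃ n, e n = q) ∧ ∀ x, μ {x} ≠ 0 → ∃ n, e n = x := by
  have h1 : {x : ℝ | 0 < μ {x}}.Countable := by
    refine Measure.countable_meas_pos_of_disjoint_of_meas_iUnion_ne_top μ
      (fun x => measurableSet_singleton x) (fun x y hxy => ?_) (measure_ne_top _ _)
    simpa using hxy
  obtain ⟨e, he⟩ := ((Set.countable_range ((↑) : ℚ → ℝ)).union h1).exists_eq_range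
    ⟨_, Or.inl ⟨0, rfl⟩⟩
  refine ⟨e, fun q => ?_, fun x hx => ?_⟩
  · have : (q : ℝ) ∈ Set.range e := he ▸ Or.inl ⟨q, rfl⟩
    exact this
  · have : x ∈ Set.range e := he ▸ Or.inr (pos_iff_ne_zero.2 hx)
    exact this

end

theorem exists_ae_abs_le {I : Set ℝ} (hIb : Bornology.IsBounded I) {μ : Measure ℝ}
    (hμ : μ Iᶜ = 0) : ∃ R, ∀ᵐ x ∂μ, |x| ≤ R := by
  obtain ⟨R, hR⟩ := hIb.exists_norm_le
  refine ⟨R, ?_⟩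
  filter_upwards [measure_eq_zero_iff_ae_notMem.1 hμ] with x hx
  exact hR x (Set.notMem_compl_iff.1 hx)

theorem theorem3p2 (I : Set ℝ) (hI : I.OrdConnected) (hIb : Bornology.IsBounded I)
    (μ : Measure ℝ) [IsFiniteMeasure μ] (hμ : μ Iᶜ = 0) (ν : Measure ℝ)
    (hne : (sobolevTransportMaps μ ν).Nonempty) :
    ∃ T ∈ sobolevTransportMaps μ ν, ∀ S ∈ sobolevTransportMaps μ ν,
      transportEnergy μ T ≤ transportEnergy μ S := by
  obtain ⟨R, hb⟩ := exists_ae_abs_le hIb hμ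
  let J : Lp ℝ 2 μ → ℝ := fun T => ‖T - idLp hb‖ ^ 2 + ‖tangentialGradient μ T‖ ^ 2
  have hJ0 : ∀ T, 0 ≤ J T := fun T => by positivity
  have hbdd : BddBelow (J '' sobolevTransportMaps μ ν) := ⟨0, by
    rintro _ ⟨T, -, rfl⟩
    exact hJ0 T⟩
  set m := sInf (J '' sobolevTransportMaps μ ν) with hm
  obtain ⟨r, -, hr, hrmem⟩ := exists_seq_tendsto_sInf (hne.image J) hbdd
  choose f hfmem hfr using hrmem
  obtain ⟨T₀, hT₀⟩ := hne
  have hnorm : ∀ S ∈ sobolevTransportMaps μ ν, ‖S‖ = ‖T₀‖ := fun S hS =>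
    norm_eq_of_map_eq (hS.2.trans hT₀.2.symm)
  obtain ⟨C, hC⟩ := hr.bddAbove_range
  have hgrad : ∀ n, ‖tangentialGradient μ (f n)‖ ≤ Real.sqrt C := by
    intro n
    refine Real.le_sqrt_of_sq_le ?_
    have h1 : J (f n) ≤ C := hfr n ▸ hC ⟨n, rfl⟩
    have h2 : 0 ≤ ‖f n - idLp hb‖ ^ 2 := by positivity
    have h3 : J (f n) = ‖f n - idLp hb‖ ^ 2 + ‖tangentialGradient μ (f n)‖ ^ 2 := rfl
    linarith
  have : Fact ((2 : ℝ≥0∞) ≠ ⊤) := ⟨ENNReal.ofNat_ne_top⟩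
  obtain ⟨T, σ, hσ, hT⟩ := exists_subseq_tendsto_inner (x := f) fun n =>
    (hnorm _ (hfmem n)).le
  obtain ⟨v, τ, hτ, hv⟩ := exists_subseq_tendsto_inner
    (x := fun n => tangentialGradient μ (f (σ n))) fun n => hgrad (σ n)
  set k : ℕ → ℕ := fun n => σ (τ n) with hk
  have hkt : Tendsto k atTop atTop := hσ.tendsto_atTop.comp hτ.tendsto_atTop
  have hTw : ∀ w, Tendsto (fun n => inner ℝ (f (k n)) w) atTop (𝓝 (inner ℝ T w)) :=
    fun w => (hT w).comp hτ.tendsto_atTop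
  have hdual : ∀ F : StrongDual ℝ (Lp ℝ 2 μ × Lp ℝ 2 μ),
      Tendsto (fun n => F (f (k n), tangentialGradient μ (f (k n)))) atTop (𝓝 (F (T, v))) := by
    intro F
    have h1 := tendsto_dual_of_tendsto_inner hTw
      (F.comp (ContinuousLinearMap.inl ℝ (Lp ℝ 2 μ) (Lp ℝ 2 μ)))
    have h2 := tendsto_dual_of_tendsto_inner hv
      (F.comp (ContinuousLinearMap.inr ℝ (Lp ℝ 2 μ) (Lp ℝ 2 μ)))
    have h3 : ∀ a b : Lp ℝ 2 μ, F (a, b) = F (a, 0) + F (0, b) := fun a b => by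
      rw [← map_add, Prod.mk_add_mk, add_zero, zero_add]
    rw [h3]
    exact (h1.add h2).congr fun n => (h3 (f (k n)) (tangentialGradient μ (f (k n)))).symm
  have hgraph : ∀ n, (f (k n), tangentialGradient μ (f (k n))) ∈ sobolevGraph hb := fun n =>
    (mem_gradients_iff_mem_sobolevGraph hb).1 (tangentialGradient_spec (hfmem (k n)).1).1
  have hTv : (T, v) ∈ sobolevGraph hb :=
    Submodule.mem_of_tendsto_dual (isClosed_sobolevGraph hb) hgraph hdual
  obtain ⟨e, heq, hea⟩ := exists_seq_rat_atoms μ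
  have hatom : ∀ x ∈ unlinkedSet μ e, μ {x} = 0 := by
    intro x hx
    by_contra h0
    obtain ⟨n, hn⟩ := hea x h0
    exact mem_unlinkedSet.1 hx n (hn ▸ Linked.refl μ _)
  obtain ⟨U, hUmap, hUT, hcorr⟩ := exists_transport_of_tendsto_inner hb
    (measurableSet_unlinkedSet hb e) hatom (fun n => (hfmem (k n)).2) hTw
    (ae_tendsto_of_tendsto_dual hb e hgraph hTv hdual)
  have hflat : U - T ∈ flatFunctions hb := by
    refine mem_flatFunctions_of_ae_eq_zero hb heq ?_
    filter_upwards [hUT, Lp.coeFn_sub U T] with x h1 h2 hx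
    rw [h2, Pi.sub_apply, h1 hx, sub_self]
  have hUv : v ∈ gradients μ U := by
    rw [mem_gradients_iff_mem_sobolevGraph hb]
    have h1 := (sobolevGraph hb).add_mem hTv ((mem_flatFunctions hb).1 hflat)
    rwa [Prod.mk_add_mk, add_zero, add_sub_cancel] at h1
  have hUmem : U ∈ sobolevTransportMaps μ ν := ⟨⟨v, hUv⟩, hUmap⟩
  have hJeq : ∀ S ∈ sobolevTransportMaps μ ν, J S = ‖T₀‖ ^ 2 - 2 * inner ℝ S (idLp hb) +
      ‖idLp hb‖ ^ 2 + ‖tangentialGradient μ S‖ ^ 2 := fun S hS => by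
    simp only [J]
    rw [norm_sub_sq_real, hnorm S hS]
  have hlim : Tendsto (fun n => ‖tangentialGradient μ (f (k n))‖) atTop
      (𝓝 (Real.sqrt (m - (‖T₀‖ ^ 2 - 2 * inner ℝ T (idLp hb) + ‖idLp hb‖ ^ 2)))) := by
    have h1 : Tendsto (fun n => r (k n) - (‖T₀‖ ^ 2 - 2 * inner ℝ (f (k n)) (idLp hb) +
        ‖idLp hb‖ ^ 2)) atTop
        (𝓝 (m - (‖T₀‖ ^ 2 - 2 * inner ℝ T (idLp hb) + ‖idLp hb‖ ^ 2))) :=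
      (hr.comp hkt).sub ((((hTw (idLp hb)).const_mul 2).const_sub _).add_const _)
    refine h1.sqrt.congr fun n => ?_
    rw [← hfr, hJeq _ (hfmem _), add_sub_cancel_left, Real.sqrt_sq (norm_nonneg _)]
  have hnn : 0 ≤ m - (‖T₀‖ ^ 2 - 2 * inner ℝ T (idLp hb) + ‖idLp hb‖ ^ 2) := by
    refine ge_of_tendsto' ((hr.comp hkt).sub
      ((((hTw (idLp hb)).const_mul 2).const_sub (‖T₀‖ ^ 2)).add_const (‖idLp hb‖ ^ 2)))
      fun n => ?_
    simp only [Function.comp]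
    rw [← hfr, hJeq _ (hfmem _), add_sub_cancel_left]
    positivity
  have hvle : ‖tangentialGradient μ U‖ ^ 2 ≤
      m - (‖T₀‖ ^ 2 - 2 * inner ℝ T (idLp hb) + ‖idLp hb‖ ^ 2) := by
    rw [← Real.le_sqrt (norm_nonneg _) hnn]
    exact ((tangentialGradient_spec hUmem.1).2 v hUv).trans (norm_le_of_tendsto_inner hv hlim)
  refine ⟨U, hUmem, fun S hS => ?_⟩
  rw [transportEnergy_eq hb, transportEnergy_eq hb]
  refine ENNReal.ofReal_le_ofReal ?_
  change J U ≤ J S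
  have h1 : m ≤ J S := csInf_le hbdd ⟨S, hS, rfl⟩
  rw [← inner_idLp hb, ← inner_idLp hb] at hcorr
  rw [hJeq U hUmem]
  linarith
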